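/- Conventions. Let $\mathcal C$ be a quasistrict symmetric monoidal 2-category: a strict 2-category with a strictly associative and unital tensor product $\otimes$ with unit $1$, for which tensoring with an object on either side is a strict 2-functor, with natural invertible interchangers $\varphi_{f,g}:(f\otimes\mathrm{id})\circ(\mathrm{id}\otimes g)\Rightarrow(\mathrm{id}\otimes g)\circ(f\otimes\mathrm{id})$ compatible with $\circ$ and $\otimes$, and with braiding 1-isomorphisms $\gamma_{A,B}:A\otimes B\to B\otimes A$ that satisfy naturality, symmetry and the hexagon equations on the nose, the interchangers of $\gamma$ with any 1-morphism being identities. Identities and whiskerings are suppressed below; 2-morphisms are composed vertically from left to right, separated by semicolons. A ribbon object in $\mathcal C$ consists of an object $X$; 1-morphisms $M:X\otimes X\to X$ (pants), $\Delta:X\to X\otimes X$ (copants), $u:1\to X$ (cup), $e:X\to 1$ (cap); invertible 2-morphisms $\alpha:M(M\otimes 1)\Rightarrow M(1\otimes M)$, $\rho:M(1\otimes u)\Rightarrow \mathrm{id}$, $\lambda:M(u\otimes 1)\Rightarrow\mathrm{id}$, $\beta:M\Rightarrow M\gamma_{X,X}$, $\theta:\mathrm{id}_X\Rightarrow\mathrm{id}_X$;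 and 2-morphisms $\eta:\mathrm{id}\Rightarrow\Delta M$, $\epsilon:M\Delta\Rightarrow\mathrm{id}$, $\nu:\mathrm{id}\Rightarrow eu$, $\mu:ue\Rightarrow\mathrm{id}$ together with 2-morphisms $\eta^\dagger,\epsilon^\dagger,\nu^\dagger,\mu^\dagger$ in the reverse directions, such that: * (Monoidal) $\alpha,\lambda,\rho$ satisfy the pentagon (with $\varphi_{M,M}^{-1}$ in it) and the unit triangle; * (Balanced) $\alpha,\beta$ satisfy the hexagon; on $M$ one has $\theta=\beta^2;(\theta\otimes\theta)$, where $\beta^2:=\beta;\beta:M\Rightarrow M\gamma_{X,X}\gamma_{X,X}=M$; and $\theta$ is the identity on $u$; * (Rigidity) $\phi_l:=(\eta;\alpha;\epsilon):(M\otimes1)(1\otimes\Delta)\Rightarrow\Delta M$ and $\phi_r:=(\eta;\alpha^{-1};\epsilon):(1\otimes M)(\Delta\otimes1)\Rightarrow\Delta M$ are invertible with inverses $(\epsilon^\dagger;\alpha^{-1};\eta^\dagger)$ and $(\epsilon^\dagger;\alpha;\eta^\dagger)$ respectively; * (Ribbon) $\theta\otimes1=1\otimes\theta$ on $\Delta u$;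 * (Biadjoint) $M\dashv\Delta$ via $\eta,\epsilon$ and $\Delta\dashv M$ via $\epsilon^\dagger,\eta^\dagger$; $u\dashv e$ via $\nu,\mu$ and $e\dashv u$ via $\mu^\dagger,\nu^\dagger$; * (Pivotality) on $eu$, the composite $\epsilon^\dagger;\mu^\dagger;\mu;\epsilon$ is the identity, where $\mu^\dagger$ and $\mu$ act on the right leg of $M\Delta$, and likewise with the left leg. Put $\mathrm{II}:=\phi_l^{-1};(1\otimes\theta\otimes1);\phi_l:\Delta M\Rightarrow\Delta M$, with inverse $\mathrm{II}^{-1}=\phi_l^{-1};(1\otimes\theta^{-1}\otimes1);\phi_l$, and let $A:M\Delta\Rightarrow M\Delta$ be the composite $$M\Delta\xrightarrow{\;M\Delta\epsilon^\dagger\;}M\Delta M\Delta\xrightarrow{\;M\,\mathrm{II}^{-1}\Delta\;}M\Delta M\Delta\xrightarrow{\;\epsilon M\Delta\;}M\Delta ,$$ with dagger $A^\dagger:=(\epsilon^\dagger M\Delta);(M\,\mathrm{II}\,\Delta);(M\Delta\epsilon)$. Call $M\Delta$ the twice-punctured torus and $M\Delta u$ the once-punctured torus. Proposition. For every ribbon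 object in every quasistrict symmetric monoidal 2-category, the following are equivalent: 1. (Modularity) the two equations $\epsilon^\dagger;(\theta\otimes\theta^{-1});\epsilon=\mu^\dagger;\mu$ and $\epsilon^\dagger;(\theta^{-1}\otimes\theta);\epsilon=\mu^\dagger;\mu$ between 2-morphisms $\mathrm{id}_X\Rightarrow\mathrm{id}_X$ hold, where $\theta^{\pm1}\otimes\theta^{\mp1}$ acts on the two legs of $M\Delta$; 2. $A$ is invertible on the twice-punctured torus with inverse $A^\dagger$, that is, $A;A^\dagger=\mathrm{id}=A^\dagger;A$ on $M\Delta$; 3. $A$ is invertible on the once-punctured torus with inverse $A^\dagger$, that is, the whiskerings $Au$ and $A^\dagger u$ are mutually inverse on $M\Delta u$. -/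

import Mathlib

/--
A quasistrict symmetric monoidal 2-category, in its stringent form: a strict 2-category with a
strictly associative and unital tensor product, in which tensoring with an object on either side is
a strict 2-functor, whose only nontrivial coherence data are the interchangers
`φ_{f,g} : (f ⊗ id) ∘ (id ⊗ g) ⇒ (id ⊗ g) ∘ (f ⊗ id)`, together with braiding 1-isomorphisms that
are natural, symmetric and satisfy the hexagon equations on the nose.

Since all the laws for objects and 1-morphisms are equations on the nose, the underlying 2-globular
set `Cell ⇉ Mor ⇉ Ob` is given by source and target maps. The composition operations are written
as total functions, but every law involving a composite is imposed only where the composite makes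
sense; the values on non-composable pairs carry no information and are never used.

Composition of 1-morphisms and horizontal composition of 2-morphisms are in functional order
(`comp g f` is `g ∘ f`); vertical composition is in diagrammatic order (`vcomp a b` is first `a`,
then `b`).
-/
structure QuasistrictSymmMonoidal2Cat.{u₀, u₁, u₂} where
  /-- objects -/
  Ob : Type u₀
  /-- 1-morphisms -/
  Mor : Type u₁
  /-- 2-morphisms -/
  Cell : Type u₂
  dom : Mor → Ob
  cod : Mor → Ob
  src : Cell → Mor
  tgt : Cell → Mor
  dom_tgt : ∀ a, dom (tgt a) = dom (src a)
  cod_tgt : ∀ a, cod (tgt a) = cod (src a)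
  -- the category of objects and 1-morphisms
  one : Ob → Mor
  comp : Mor → Mor → Mor
  dom_one : ∀ A, dom (one A) = A
  cod_one : ∀ A, cod (one A) = A
  dom_comp : ∀ g f, dom g = cod f → dom (comp g f) = dom f
  cod_comp : ∀ g f, dom g = cod f → cod (comp g f) = cod g
  comp_one : ∀ f, comp f (one (dom f)) = f
  one_comp : ∀ f, comp (one (cod f)) f = f
  comp_assoc : ∀ h g f, dom h = cod g → dom g = cod f →
    comp (comp h g) f = comp h (comp g f)
  -- vertical composition of 2-morphisms
  idc : Mor → Cell
  vcomp : Cell → Cell → Cell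
  src_idc : ∀ f, src (idc f) = f
  tgt_idc : ∀ f, tgt (idc f) = f
  src_vcomp : ∀ a b, tgt a = src b → src (vcomp a b) = src a
  tgt_vcomp : ∀ a b, tgt a = src b → tgt (vcomp a b) = tgt b
  idc_vcomp : ∀ a, vcomp (idc (src a)) a = a
  vcomp_idc : ∀ a, vcomp a (idc (tgt a)) = a
  vcomp_assoc : ∀ a b c, tgt a = src b → tgt b = src c →
    vcomp (vcomp a b) c = vcomp a (vcomp b c)
  -- horizontal composition of 2-morphisms
  hcomp : Cell → Cell → Cell
  src_hcomp : ∀ b a, dom (src b) = cod (src a) → src (hcomp b a) = comp (src b) (src a)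
  tgt_hcomp : ∀ b a, dom (src b) = cod (src a) → tgt (hcomp b a) = comp (tgt b) (tgt a)
  hcomp_idc : ∀ g f, dom g = cod f → hcomp (idc g) (idc f) = idc (comp g f)
  hcomp_one : ∀ a, hcomp a (idc (one (dom (src a)))) = a
  one_hcomp : ∀ a, hcomp (idc (one (cod (src a)))) a = a
  hcomp_assoc : ∀ c b a, dom (src c) = cod (src b) → dom (src b) = cod (src a) →
    hcomp (hcomp c b) a = hcomp c (hcomp b a)
  hcomp_vcomp : ∀ b b' a a', tgt a = src a' → tgt b = src b' → dom (src b) = cod (src a) →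
    hcomp (vcomp b b') (vcomp a a') = vcomp (hcomp b a) (hcomp b' a')
  -- tensor product of objects; the unit object is `1`
  [monoidOb : Monoid Ob]
  -- tensoring with an object on the left (`tl`) and on the right (`tr`): strict 2-functors
  tl : Ob → Mor → Mor
  tr : Mor → Ob → Mor
  tl₂ : Ob → Cell → Cell
  tr₂ : Cell → Ob → Cell
  dom_tl : ∀ A f, dom (tl A f) = A * dom f
  cod_tl : ∀ A f, cod (tl A f) = A * cod f
  dom_tr : ∀ f A, dom (tr f A) = dom f * A
  cod_tr : ∀ f A, cod (tr f A) = cod f * A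
  tl_one : ∀ A B, tl A (one B) = one (A * B)
  tr_one : ∀ A B, tr (one A) B = one (A * B)
  tl_comp : ∀ A g f, dom g = cod f → tl A (comp g f) = comp (tl A g) (tl A f)
  tr_comp : ∀ g f A, dom g = cod f → tr (comp g f) A = comp (tr g A) (tr f A)
  src_tl₂ : ∀ A a, src (tl₂ A a) = tl A (src a)
  tgt_tl₂ : ∀ A a, tgt (tl₂ A a) = tl A (tgt a)
  src_tr₂ : ∀ a A, src (tr₂ a A) = tr (src a) A
  tgt_tr₂ : ∀ a A, tgt (tr₂ a A) = tr (tgt a) A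
  tl₂_idc : ∀ A f, tl₂ A (idc f) = idc (tl A f)
  tr₂_idc : ∀ f A, tr₂ (idc f) A = idc (tr f A)
  tl₂_vcomp : ∀ A a b, tgt a = src b → tl₂ A (vcomp a b) = vcomp (tl₂ A a) (tl₂ A b)
  tr₂_vcomp : ∀ a b A, tgt a = src b → tr₂ (vcomp a b) A = vcomp (tr₂ a A) (tr₂ b A)
  tl₂_hcomp : ∀ A b a, dom (src b) = cod (src a) →
    tl₂ A (hcomp b a) = hcomp (tl₂ A b) (tl₂ A a)
  tr₂_hcomp : ∀ b a A, dom (src b) = cod (src a) →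
    tr₂ (hcomp b a) A = hcomp (tr₂ b A) (tr₂ a A)
  -- strict unitality and associativity of the tensor product
  unit_tl : ∀ f, tl 1 f = f
  tr_unit : ∀ f, tr f 1 = f
  unit_tl₂ : ∀ a, tl₂ 1 a = a
  tr₂_unit : ∀ a, tr₂ a 1 = a
  tl_tl : ∀ A B f, tl A (tl B f) = tl (A * B) f
  tr_tl : ∀ A f B, tr (tl A f) B = tl A (tr f B)
  tr_tr : ∀ f A B, tr (tr f A) B = tr f (A * B)
  tl₂_tl₂ : ∀ A B a, tl₂ A (tl₂ B a) = tl₂ (A * B) a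
  tr₂_tl₂ : ∀ A a B, tr₂ (tl₂ A a) B = tl₂ A (tr₂ a B)
  tr₂_tr₂ : ∀ a A B, tr₂ (tr₂ a A) B = tr₂ a (A * B)
  -- the interchanger 2-isomorphisms and their inverses
  xch : Mor → Mor → Cell
  xchInv : Mor → Mor → Cell
  src_xch : ∀ f g, src (xch f g) = comp (tr f (cod g)) (tl (dom f) g)
  tgt_xch : ∀ f g, tgt (xch f g) = comp (tl (cod f) g) (tr f (dom g))
  src_xchInv : ∀ f g, src (xchInv f g) = comp (tl (cod f) g) (tr f (dom g))
  tgt_xchInv : ∀ f g, tgt (xchInv f g) = comp (tr f (cod g)) (tl (dom f) g)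
  xch_xchInv : ∀ f g, vcomp (xch f g) (xchInv f g) = idc (comp (tr f (cod g)) (tl (dom f) g))
  xchInv_xch : ∀ f g, vcomp (xchInv f g) (xch f g) = idc (comp (tl (cod f) g) (tr f (dom g)))
  -- the interchangers are natural, compatible with composition and with tensoring by objects
  xch_nat_left : ∀ a g,
    vcomp (hcomp (tr₂ a (cod g)) (idc (tl (dom (src a)) g))) (xch (tgt a) g) =
      vcomp (xch (src a) g) (hcomp (idc (tl (cod (src a)) g)) (tr₂ a (dom g)))
  xch_nat_right : ∀ f b,
    vcomp (hcomp (idc (tr f (cod (src b)))) (tl₂ (dom f) b)) (xch f (tgt b)) =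
      vcomp (xch f (src b)) (hcomp (tl₂ (cod f) b) (idc (tr f (dom (src b)))))
  xch_one_left : ∀ A g, xch (one A) g = idc (tl A g)
  xch_one_right : ∀ f B, xch f (one B) = idc (tr f B)
  xch_comp_left : ∀ f' f g, dom f' = cod f →
    xch (comp f' f) g = vcomp (hcomp (idc (tr f' (cod g))) (xch f g))
      (hcomp (xch f' g) (idc (tr f (dom g))))
  xch_comp_right : ∀ f g' g, dom g' = cod g →
    xch f (comp g' g) = vcomp (hcomp (xch f g') (idc (tl (dom f) g)))
      (hcomp (idc (tl (cod f) g')) (xch f g))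
  xch_tl_left : ∀ A f g, xch (tl A f) g = tl₂ A (xch f g)
  xch_tr_left : ∀ f A g, xch (tr f A) g = xch f (tl A g)
  xch_tr_right : ∀ f g A, xch f (tr g A) = tr₂ (xch f g) A
  -- the braiding 1-isomorphisms `γ_{A,B} : A ⊗ B → B ⊗ A`
  br : Ob → Ob → Mor
  dom_br : ∀ A B, dom (br A B) = A * B
  cod_br : ∀ A B, cod (br A B) = B * A
  br_br : ∀ A B, comp (br B A) (br A B) = one (A * B)
  br_mul_left : ∀ A B C, br (A * B) C = comp (tr (br A C) B) (tl A (br B C))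
  br_mul_right : ∀ A B C, br A (B * C) = comp (tl B (br A C)) (tr (br A B) C)
  br_nat_left : ∀ f B, comp (br (cod f) B) (tr f B) = comp (tl B f) (br (dom f) B)
  br_nat_right : ∀ A g, comp (br A (cod g)) (tl A g) = comp (tr g A) (br A (dom g))
  br_nat_left₂ : ∀ a B, hcomp (idc (br (cod (src a)) B)) (tr₂ a B) =
    hcomp (tl₂ B a) (idc (br (dom (src a)) B))
  br_nat_right₂ : ∀ A b, hcomp (idc (br A (cod (src b)))) (tl₂ A b) =
    hcomp (tr₂ b A) (idc (br A (dom (src b))))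
  -- compatibility of the interchangers with the braiding
  xch_br_right : ∀ f B C, xch f (br B C) = idc (comp (tr f (C * B)) (tl (dom f) (br B C)))
  xch_br_left : ∀ A B g, xch (br A B) g = idc (comp (tr (br A B) (cod g)) (tl (A * B) g))
  br_xch : ∀ f g,
    vcomp (hcomp (idc (br (cod f) (cod g))) (xch f g)) (hcomp (xch g f) (idc (br (dom f) (dom g))))
      = idc (comp (br (cod f) (cod g)) (comp (tr f (cod g)) (tl (dom f) g)))

attribute [instance] QuasistrictSymmMonoidal2Cat.monoidOb

/-- `g ∘₁ f` : composite of 1-morphisms, `f` first. -/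
notation:80 g:81 " ∘₁ " f:80 => QuasistrictSymmMonoidal2Cat.comp _ g f
/-- `A ◁₁ f` is `id_A ⊗ f`. -/
notation:90 A:91 " ◁₁ " f:90 => QuasistrictSymmMonoidal2Cat.tl _ A f
/-- `f ▷₁ A` is `f ⊗ id_A`. -/
notation:91 f:91 " ▷₁ " A:92 => QuasistrictSymmMonoidal2Cat.tr _ f A
/-- `A ◁₂ a` is `id_A ⊗ a` for a 2-morphism `a`. -/
notation:90 A:91 " ◁₂ " a:90 => QuasistrictSymmMonoidal2Cat.tl₂ _ A a
/-- `a ▷₂ A` is `a ⊗ id_A` for a 2-morphism `a`. -/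
notation:91 a:91 " ▷₂ " A:92 => QuasistrictSymmMonoidal2Cat.tr₂ _ a A
/-- `g ∘ₗ a` : the 2-morphism `a` whiskered by the 1-morphism `g` after it. -/
notation:80 g:81 " ∘ₗ " a:80 =>
  QuasistrictSymmMonoidal2Cat.hcomp _ (QuasistrictSymmMonoidal2Cat.idc _ g) a
/-- `a ∘ᵣ f` : the 2-morphism `a` whiskered by the 1-morphism `f` before it. -/
notation:81 a:82 " ∘ᵣ " f:81 =>
  QuasistrictSymmMonoidal2Cat.hcomp _ a (QuasistrictSymmMonoidal2Cat.idc _ f)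
/-- `a ⟫ b` : vertical composite, first `a`, then `b`. -/
notation:60 a:61 " ⟫ " b:60 => QuasistrictSymmMonoidal2Cat.vcomp _ a b

/-- An interpretation of the generators of the ribbon presentation in a quasistrict symmetric
monoidal 2-category: an object (the circle), the pair of pants `M`, the copants `D`, the cup `u`,
the cap `e`, the 2-morphisms `α, ρ, lam, β, θ` with candidate inverses (suffix `i`) and
`η, ε, ν, μ` with daggers (suffix `d`). -/
structure RibbonData (C : QuasistrictSymmMonoidal2Cat) where
  X : C.Ob
  M : C.Mor
  D : C.Mor
  u : C.Mor
  e : C.Mor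
  dom_M : C.dom M = X * X
  cod_M : C.cod M = X
  dom_D : C.dom D = X
  cod_D : C.cod D = X * X
  dom_u : C.dom u = 1
  cod_u : C.cod u = X
  dom_e : C.dom e = X
  cod_e : C.cod e = 1
  /-- associator `M ∘ (M ⊗ id) ⇒ M ∘ (id ⊗ M)` -/
  α : C.Cell
  αi : C.Cell
  src_α : C.src α = M ∘₁ (M ▷₁ X)
  tgt_α : C.tgt α = M ∘₁ (X ◁₁ M)
  src_αi : C.src αi = M ∘₁ (X ◁₁ M)
  tgt_αi : C.tgt αi = M ∘₁ (M ▷₁ X)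
  /-- right unitor `M ∘ (id ⊗ u) ⇒ id` -/
  ρ : C.Cell
  ρi : C.Cell
  src_ρ : C.src ρ = M ∘₁ (X ◁₁ u)
  tgt_ρ : C.tgt ρ = C.one X
  src_ρi : C.src ρi = C.one X
  tgt_ρi : C.tgt ρi = M ∘₁ (X ◁₁ u)
  /-- left unitor `M ∘ (u ⊗ id) ⇒ id` -/
  lam : C.Cell
  lami : C.Cell
  src_lam : C.src lam = M ∘₁ (u ▷₁ X)
  tgt_lam : C.tgt lam = C.one X
  src_lami : C.src lami = C.one X
  tgt_lami : C.tgt lami = M ∘₁ (u ▷₁ X)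
  /-- braiding generator `M ⇒ M ∘ γ` -/
  β : C.Cell
  βi : C.Cell
  src_β : C.src β = M
  tgt_β : C.tgt β = M ∘₁ C.br X X
  src_βi : C.src βi = M ∘₁ C.br X X
  tgt_βi : C.tgt βi = M
  /-- twist `id ⇒ id` -/
  θ : C.Cell
  θi : C.Cell
  src_θ : C.src θ = C.one X
  tgt_θ : C.tgt θ = C.one X
  src_θi : C.src θi = C.one X
  tgt_θi : C.tgt θi = C.one X
  /-- `η : id ⇒ D ∘ M` and its dagger -/
  η : C.Cell
  ηd : C.Cell
  src_η : C.src η = C.one (X * X)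
  tgt_η : C.tgt η = D ∘₁ M
  src_ηd : C.src ηd = D ∘₁ M
  tgt_ηd : C.tgt ηd = C.one (X * X)
  /-- `ε : M ∘ D ⇒ id` and its dagger -/
  ε : C.Cell
  εd : C.Cell
  src_ε : C.src ε = M ∘₁ D
  tgt_ε : C.tgt ε = C.one X
  src_εd : C.src εd = C.one X
  tgt_εd : C.tgt εd = M ∘₁ D
  /-- `ν : id ⇒ e ∘ u` and its dagger -/
  ν : C.Cell
  νd : C.Cell
  src_ν : C.src ν = C.one 1
  tgt_ν : C.tgt ν = e ∘₁ u
  src_νd : C.src νd = e ∘₁ u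
  tgt_νd : C.tgt νd = C.one 1
  /-- `μ : u ∘ e ⇒ id` and its dagger -/
  μ : C.Cell
  μd : C.Cell
  src_μ : C.src μ = u ∘₁ e
  tgt_μ : C.tgt μ = C.one X
  src_μd : C.src μd = C.one X
  tgt_μd : C.tgt μd = u ∘₁ e

namespace RibbonData

variable {C : QuasistrictSymmMonoidal2Cat} (P : RibbonData C)

/-- The symmetry 1-isomorphism `X ⊗ X → X ⊗ X` of the ambient 2-category. -/
def γ : C.Mor := C.br P.X P.X

/-- The 2-morphism `a ⊗ b` of `id_{X ⊗ X}`, for 2-morphisms `a, b` of `id_X`. -/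
def two (a b : C.Cell) : C.Cell := (a ▷₂ P.X) ⟫ (P.X ◁₂ b)

/-- The source `(M ⊗ id) ∘ (id ⊗ D)` of the left Frobeniusator. -/
def frobL : C.Mor := (P.M ▷₁ P.X) ∘₁ (P.X ◁₁ P.D)

/-- The source `(id ⊗ M) ∘ (D ⊗ id)` of the right Frobeniusator. -/
def frobR : C.Mor := (P.X ◁₁ P.M) ∘₁ (P.D ▷₁ P.X)

/-- The left Frobeniusator `(M ⊗ id) ∘ (id ⊗ D) ⇒ D ∘ M`. -/
def phiL : C.Cell :=
  (P.η ∘ᵣ P.frobL) ⟫ (P.D ∘ₗ P.α ∘ᵣ (P.X ◁₁ P.D)) ⟫ ((P.D ∘₁ P.M) ∘ₗ (P.X ◁₂ P.ε))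

/-- The prescribed inverse `D ∘ M ⇒ (M ⊗ id) ∘ (id ⊗ D)` of the left Frobeniusator. -/
def phiLInv : C.Cell :=
  ((P.D ∘₁ P.M) ∘ₗ (P.X ◁₂ P.εd)) ⟫ (P.D ∘ₗ P.αi ∘ᵣ (P.X ◁₁ P.D)) ⟫ (P.ηd ∘ᵣ P.frobL)

/-- The right Frobeniusator `(id ⊗ M) ∘ (D ⊗ id) ⇒ D ∘ M`. -/
def phiR : C.Cell :=
  (P.η ∘ᵣ P.frobR) ⟫ (P.D ∘ₗ P.αi ∘ᵣ (P.D ▷₁ P.X)) ⟫ ((P.D ∘₁ P.M) ∘ₗ (P.ε ▷₂ P.X))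

/-- The prescribed inverse `D ∘ M ⇒ (id ⊗ M) ∘ (D ⊗ id)` of the right Frobeniusator. -/
def phiRInv : C.Cell :=
  ((P.D ∘₁ P.M) ∘ₗ (P.εd ▷₂ P.X)) ⟫ (P.D ∘ₗ P.α ∘ᵣ (P.D ▷₁ P.X)) ⟫ (P.ηd ∘ᵣ P.frobR)

/-- The invertible generators are inverse to their formal inverses. -/
structure Inverses : Prop where
  α_αi : P.α ⟫ P.αi = C.idc (P.M ∘₁ (P.M ▷₁ P.X))
  αi_α : P.αi ⟫ P.α = C.idc (P.M ∘₁ (P.X ◁₁ P.M))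
  ρ_ρi : P.ρ ⟫ P.ρi = C.idc (P.M ∘₁ (P.X ◁₁ P.u))
  ρi_ρ : P.ρi ⟫ P.ρ = C.idc (C.one P.X)
  lam_lami : P.lam ⟫ P.lami = C.idc (P.M ∘₁ (P.u ▷₁ P.X))
  lami_lam : P.lami ⟫ P.lam = C.idc (C.one P.X)
  β_βi : P.β ⟫ P.βi = C.idc P.M
  βi_β : P.βi ⟫ P.β = C.idc (P.M ∘₁ P.γ)
  θ_θi : P.θ ⟫ P.θi = C.idc (C.one P.X)
  θi_θ : P.θi ⟫ P.θ = C.idc (C.one P.X)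

/-- Pentagon (with the inverse interchanger of `M` and `M`) and unit triangle. -/
structure Monoidal : Prop where
  pentagon :
    (P.α ∘ᵣ ((P.M ▷₁ P.X) ▷₁ P.X)) ⟫ (P.M ∘ₗ C.xchInv P.M P.M) ⟫
        (P.α ∘ᵣ (P.X ◁₁ P.X ◁₁ P.M)) =
      (P.M ∘ₗ (P.α ▷₂ P.X)) ⟫ (P.α ∘ᵣ (P.X ◁₁ (P.M ▷₁ P.X))) ⟫ (P.M ∘ₗ (P.X ◁₂ P.α))
  triangle :
    P.M ∘ₗ (P.ρ ▷₂ P.X) = (P.α ∘ᵣ (P.X ◁₁ (P.u ▷₁ P.X))) ⟫ (P.M ∘ₗ (P.X ◁₂ P.lam))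

/-- Hexagon and the compatibility of the twist with `M` and `u`. -/
structure Balanced : Prop where
  hexagon :
    P.α ⟫ (P.β ∘ᵣ (P.X ◁₁ P.M)) ⟫ (P.α ∘ᵣ C.br P.X (P.X * P.X)) =
      (P.M ∘ₗ (P.β ▷₂ P.X)) ⟫ (P.α ∘ᵣ (P.γ ▷₁ P.X)) ⟫
        (P.M ∘ₗ (P.X ◁₂ P.β) ∘ᵣ (P.γ ▷₁ P.X))
  twist_M : P.θ ∘ᵣ P.M = P.β ⟫ (P.β ∘ᵣ P.γ) ⟫ (P.M ∘ₗ P.two P.θ P.θ)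
  twist_u : P.θ ∘ᵣ P.u = C.idc P.u

/-- The Frobeniusators are invertible with the prescribed inverses. -/
structure Rigidity : Prop where
  phiL_phiLInv : P.phiL ⟫ P.phiLInv = C.idc P.frobL
  phiLInv_phiL : P.phiLInv ⟫ P.phiL = C.idc (P.D ∘₁ P.M)
  phiR_phiRInv : P.phiR ⟫ P.phiRInv = C.idc P.frobR
  phiRInv_phiR : P.phiRInv ⟫ P.phiR = C.idc (P.D ∘₁ P.M)

/-- On the bent cylinder `D ∘ u` the twists of the two legs agree. -/
def Ribbon : Prop :=
  (P.θ ▷₂ P.X) ∘ᵣ (P.D ∘₁ P.u) = (P.X ◁₂ P.θ) ∘ᵣ (P.D ∘₁ P.u)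

/-- `D` is biadjoint to `M` and `e` is biadjoint to `u`. -/
structure Biadjoint : Prop where
  cup : (P.u ∘ₗ P.ν) ⟫ (P.μ ∘ᵣ P.u) = C.idc P.u
  cap : (P.ν ∘ᵣ P.e) ⟫ (P.e ∘ₗ P.μ) = C.idc P.e
  cup_dagger : (P.μd ∘ᵣ P.u) ⟫ (P.u ∘ₗ P.νd) = C.idc P.u
  cap_dagger : (P.e ∘ₗ P.μd) ⟫ (P.νd ∘ᵣ P.e) = C.idc P.e
  pants : (P.M ∘ₗ P.η) ⟫ (P.ε ∘ᵣ P.M) = C.idc P.M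
  copants : (P.η ∘ᵣ P.D) ⟫ (P.D ∘ₗ P.ε) = C.idc P.D
  pants_dagger : (P.εd ∘ᵣ P.M) ⟫ (P.M ∘ₗ P.ηd) = C.idc P.M
  copants_dagger : (P.D ∘ₗ P.εd) ⟫ (P.ηd ∘ᵣ P.D) = C.idc P.D

/-- On the sphere `e ∘ u`: open a hole, cut one of its legs, reglue it, and close the hole. -/
structure Pivotality : Prop where
  right :
    (P.e ∘ₗ P.εd ∘ᵣ P.u) ⟫ ((P.e ∘₁ P.M) ∘ₗ (P.X ◁₂ P.μd) ∘ᵣ (P.D ∘₁ P.u)) ⟫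
        ((P.e ∘₁ P.M) ∘ₗ (P.X ◁₂ P.μ) ∘ᵣ (P.D ∘₁ P.u)) ⟫ (P.e ∘ₗ P.ε ∘ᵣ P.u) =
      C.idc (P.e ∘₁ P.u)
  left :
    (P.e ∘ₗ P.εd ∘ᵣ P.u) ⟫ ((P.e ∘₁ P.M) ∘ₗ (P.μd ▷₂ P.X) ∘ᵣ (P.D ∘₁ P.u)) ⟫
        ((P.e ∘₁ P.M) ∘ₗ (P.μ ▷₂ P.X) ∘ᵣ (P.D ∘₁ P.u)) ⟫ (P.e ∘ₗ P.ε ∘ᵣ P.u) =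
      C.idc (P.e ∘₁ P.u)

/-- The relations of the ribbon presentation. -/
structure IsRibbonObject : Prop where
  inverses : P.Inverses
  monoidal : P.Monoidal
  balanced : P.Balanced
  rigidity : P.Rigidity
  ribbon : P.Ribbon
  biadjoint : P.Biadjoint
  pivotality : P.Pivotality

/-- The Modularity relation, an equation between 2-morphisms of the cylinder `id_X`, together with
its rotation about the vertical axis, which exchanges the two legs. -/
structure Modularity : Prop where
  mod : P.εd ⟫ (P.M ∘ₗ P.two P.θ P.θi ∘ᵣ P.D) ⟫ P.ε = P.μd ⟫ P.μ
  mod_rot : P.εd ⟫ (P.M ∘ₗ P.two P.θi P.θ ∘ᵣ P.D) ⟫ P.ε = P.μd ⟫ P.μ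

/-- The missing Dehn twist `II : D ∘ M ⇒ D ∘ M`, the conjugate by the left Frobeniusator of the
twist on the cylinder that joins `D` to `M` in `(M ⊗ id) ∘ (id ⊗ D)`. -/
def II : C.Cell :=
  P.phiLInv ⟫ ((P.M ▷₁ P.X) ∘ₗ (P.X ◁₂ (P.θ ▷₂ P.X)) ∘ᵣ (P.X ◁₁ P.D)) ⟫ P.phiL

/-- The inverse of `II`. -/
def IIInv : C.Cell :=
  P.phiLInv ⟫ ((P.M ▷₁ P.X) ∘ₗ (P.X ◁₂ (P.θi ▷₂ P.X)) ∘ᵣ (P.X ◁₁ P.D)) ⟫ P.phiL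

/-- The twice-punctured torus. -/
def torus₂ : C.Mor := P.M ∘₁ P.D

/-- The once-punctured torus. -/
def torus₁ : C.Mor := P.M ∘₁ P.D ∘₁ P.u

/-- The 2-morphism `A : M ∘ D ⇒ M ∘ D`: open a hole at the bottom, apply the inverse of `II` in the
middle, close the hole at the top. -/
def A : C.Cell :=
  (P.torus₂ ∘ₗ P.εd) ⟫ (P.M ∘ₗ P.IIInv ∘ᵣ P.D) ⟫ (P.ε ∘ᵣ P.torus₂)

/-- The dagger of `A`: each constituent is replaced by its dagger, in the reverse order. -/
def Ad : C.Cell :=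
  (P.εd ∘ᵣ P.torus₂) ⟫ (P.M ∘ₗ P.II ∘ᵣ P.D) ⟫ (P.torus₂ ∘ₗ P.ε)

/-- `A` is invertible on the twice-punctured torus, with inverse its dagger. -/
def InvertibleOnTorus₂ : Prop :=
  P.A ⟫ P.Ad = C.idc P.torus₂ ∧ P.Ad ⟫ P.A = C.idc P.torus₂

/-- `A` is invertible on the once-punctured torus, with inverse its dagger. -/
def InvertibleOnTorus₁ : Prop :=
  (P.A ∘ᵣ P.u) ⟫ (P.Ad ∘ᵣ P.u) = C.idc P.torus₁ ∧
    (P.Ad ∘ᵣ P.u) ⟫ (P.A ∘ᵣ P.u) = C.idc P.torus₁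

end RibbonData

/-!
A ribbon object is treated as a pseudomonoid `M` with a copants `D` that is a bimodule: the left and
right Frobeniusators `φl`, `φr` are invertible and, by the pentagon, compatible with each other and
with `α` (`frobenius_bimodule`). Everything below is string-diagram calculus in the strict
2-category generated by `M`, `D`, `u`, `e`.

For an endomorphism `z` of `id_X`, let `twistL z` and `twistR z` be the conjugates of
`1 ⊗ z ⊗ 1` by `φl` and by `φr`, so that `II = twistL θ`. Inserting a unit into the bimodule
identity shows that the two agree as soon as `z` is the same on both legs of `D ∘ u`
(`twistL_eq_twistR`); this is the Ribbon relation for `θ`. Bending `Y : D M ⇒ D M` around a new hole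
in the two possible ways gives `bendF Y` and `bendG Y`, with `A = bendG (twistL θ⁻¹)` and
`A† = bendF (twistL θ)`. Two computations carry the proof:

* `bendG_twistL`: `bendG (twistL z) = bendF (twistR z)`, so each of `A` and `A†` can be written
  in either way;
* `bendF_comp_bendG`: `bendF (twistL w) ; bendG (twistL z) = bendF (twistR (loop z w))`, where
  `loop z w = ε† ; (z ⊗ w) ; ε` is the composite around a hole. Hence `A ; A†` and `A† ; A` are
  `bendF (twistR _)` of the left-hand sides of the two Modularity equations.

It remains to compare `bendF (twistR (loop _ _))` with the identity. On the one hand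
`bendF (twistR (μ† ; μ))` is the identity (`bendF_twistR_neck`): pivotality and the adjunction
`u ⊣ e` show that a hole with one leg cut and reglued is trivial (`loop_neck_right`,
`loop_neck_left`), and with the triangle identity this makes the mate of
`ε† M ; M (twistR (μ† ; μ))` equal to `η`. So Modularity gives invertibility on the
twice-punctured torus, and whiskering with `u` gives it on the once-punctured torus. On the other
hand `z` can be recovered from `bendF (twistR z) u` (`eq_of_bendF_cup`): the adjunctions strip off
the pants and leave `1 ⊗ z ⊗ 1` on three legs hanging from a cup, after which caps, together with
the triviality of cut holes, remove the two outer legs. Applied to `loop θ θ⁻¹` and `loop θ⁻¹ θ`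
against `μ† ; μ`, this returns Modularity.

Whiskered 2-morphisms are encoded as `slice L a R`: a 2-morphism `a` between lists of layers, with
further layers `L` after it and `R` before it. Slices multiply in the semigroup `Diag C` of
partially defined vertical composites, so that equations between pasting diagrams become equations
between words, rewritten by the interchange law `exch` and by the relations of the presentation.
-/

/-! ### Words of 1-morphisms and whiskered 2-morphisms -/

namespace QuasistrictSymmMonoidal2Cat
variable (C : QuasistrictSymmMonoidal2Cat)

theorem one_comp_of_cod {f : C.Mor} {A : C.Ob} (h : C.cod f = A) : C.comp (C.one A) f = f := by
  rw [← h, C.one_comp]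

theorem comp_one_of_dom {f : C.Mor} {A : C.Ob} (h : C.dom f = A) : C.comp f (C.one A) = f := by
  rw [← h, C.comp_one]

theorem one_hcomp_of_cod {a : C.Cell} {A : C.Ob} (h : C.cod (C.src a) = A) :
    C.hcomp (C.idc (C.one A)) a = a := by
  rw [← h, C.one_hcomp]

theorem hcomp_one_of_dom {a : C.Cell} {A : C.Ob} (h : C.dom (C.src a) = A) :
    C.hcomp a (C.idc (C.one A)) = a := by
  rw [← h, C.hcomp_one]

theorem idc_vcomp_of_src {a : C.Cell} {f : C.Mor} (h : C.src a = f) :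
    C.vcomp (C.idc f) a = a := by
  rw [← h, C.idc_vcomp]

theorem vcomp_idc_of_tgt {a : C.Cell} {f : C.Mor} (h : C.tgt a = f) :
    C.vcomp a (C.idc f) = a := by
  rw [← h, C.vcomp_idc]

end QuasistrictSymmMonoidal2Cat

namespace RibbonData

open QuasistrictSymmMonoidal2Cat

variable {C : QuasistrictSymmMonoidal2Cat}

/-- A 1-morphism `X ^ n → X ^ m`, presented as `id ⊗ base ⊗ id` with `left` and `right` copies of `X`
on the two sides. Recording the numbers of strands makes the strict associativity of the tensor
product of objects an equation between numerals, and recording `left` and `right` makes the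
operations `id_X ⊗ -` and `- ⊗ id_X` commute definitionally. -/
structure Layer (P : RibbonData C) (n m : ℕ) where
  base : C.Mor
  left : ℕ
  right : ℕ
  dom_base : P.X ^ left * (C.dom base * P.X ^ right) = P.X ^ n
  cod_base : P.X ^ left * (C.cod base * P.X ^ right) = P.X ^ m

/-- A composable sequence of layers, the outermost (last applied) first. -/
inductive Path (P : RibbonData C) : ℕ → ℕ → Type _
  | nil {n : ℕ} : Path P n n
  | cons {a b c : ℕ} (f : Layer P b c) (p : Path P a b) : Path P a c

/-- The layers to the left of a position in a composite, the nearest one first. -/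
inductive Ctx (P : RibbonData C) : ℕ → ℕ → Type _
  | nil {n : ℕ} : Ctx P n n
  | cons {b c d : ℕ} (f : Layer P b c) (L : Ctx P c d) : Ctx P b d

variable {P : RibbonData C}

namespace Layer
variable {n m : ℕ}

/-- The underlying 1-morphism. -/
def mor (f : Layer P n m) : C.Mor := C.tl (P.X ^ f.left) (C.tr f.base (P.X ^ f.right))

theorem dom_mor (f : Layer P n m) : C.dom f.mor = P.X ^ n := by
  rw [mor, C.dom_tl, C.dom_tr, f.dom_base]

theorem cod_mor (f : Layer P n m) : C.cod f.mor = P.X ^ m := by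
  rw [mor, C.cod_tl, C.cod_tr, f.cod_base]

/-- `id_X ⊗ f`. -/
@[reducible] def tl (f : Layer P n m) : Layer P (n + 1) (m + 1) :=
  ⟨f.base, f.left + 1, f.right, by rw [pow_succ', mul_assoc, f.dom_base, pow_succ'],
    by rw [pow_succ', mul_assoc, f.cod_base, pow_succ']⟩

/-- `f ⊗ id_X`. -/
@[reducible] def tr (f : Layer P n m) : Layer P (n + 1) (m + 1) :=
  ⟨f.base, f.left, f.right + 1,
    by rw [pow_succ _ f.right, pow_succ, ← f.dom_base]; simp only [mul_assoc],
    by rw [pow_succ _ f.right, pow_succ, ← f.cod_base]; simp only [mul_assoc]⟩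

theorem mor_tl (f : Layer P n m) : f.tl.mor = C.tl P.X f.mor := by
  rw [mor, mor, C.tl_tl, pow_succ']

theorem mor_tr (f : Layer P n m) : f.tr.mor = C.tr f.mor P.X := by
  rw [mor, mor, C.tr_tl, C.tr_tr, pow_succ]

/-- A 1-morphism as a layer with nothing on the sides. -/
def ofMor (f : C.Mor) (hd : C.dom f = P.X ^ n) (hc : C.cod f = P.X ^ m) : Layer P n m :=
  ⟨f, 0, 0, by rw [pow_zero, mul_one, one_mul, hd], by rw [pow_zero, mul_one, one_mul, hc]⟩

theorem mor_ofMor (f : C.Mor) (hd : C.dom f = P.X ^ n) (hc : C.cod f = P.X ^ m) :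
    (ofMor f hd hc : Layer P n m).mor = f := by
  simp only [mor, ofMor, pow_zero, C.unit_tl, C.tr_unit]

end Layer

namespace Path
variable {a b c : ℕ}
/-- The composite of a path. -/
def ev {a b : ℕ} (p : Path P a b) : C.Mor :=
  match p with
  | nil => C.one (P.X ^ a)
  | cons f p => C.comp f.mor p.ev

theorem cod_ev_dom_ev {a : ℕ} : {b : ℕ} → (p : Path P a b) →
    C.cod p.ev = P.X ^ b ∧ C.dom p.ev = P.X ^ a
  | _, nil => ⟨by rw [ev, C.cod_one], by rw [ev, C.dom_one]⟩
  | _, cons f p => by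
    have h : C.dom f.mor = C.cod p.ev := by rw [f.dom_mor, (cod_ev_dom_ev p).1]
    exact ⟨by rw [ev, C.cod_comp _ _ h, f.cod_mor],
      by rw [ev, C.dom_comp _ _ h, (cod_ev_dom_ev p).2]⟩

@[simp] theorem cod_ev (p : Path P a b) : C.cod p.ev = P.X ^ b := p.cod_ev_dom_ev.1
@[simp] theorem dom_ev (p : Path P a b) : C.dom p.ev = P.X ^ a := p.cod_ev_dom_ev.2

/-- `id_X ⊗ p`. -/
@[reducible] def tl {a b : ℕ} (p : Path P a b) : Path P (a + 1) (b + 1) :=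
  match p with
  | nil => nil
  | cons f p => cons f.tl p.tl

/-- `p ⊗ id_X`. -/
@[reducible] def tr {a b : ℕ} (p : Path P a b) : Path P (a + 1) (b + 1) :=
  match p with
  | nil => nil
  | cons f p => cons f.tr p.tr

theorem ev_tl {a : ℕ} : {b : ℕ} → (p : Path P a b) → p.tl.ev = C.tl P.X p.ev
  | _, nil => by rw [tl, ev, ev, C.tl_one, pow_succ']
  | _, cons f p => by
    rw [tl, ev, ev, ev_tl p, Layer.mor_tl, C.tl_comp _ _ _ (by rw [f.dom_mor, cod_ev])]

theorem ev_tr {a : ℕ} : {b : ℕ} → (p : Path P a b) → p.tr.ev = C.tr p.ev P.X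
  | _, nil => by rw [tr, ev, ev, C.tr_one, pow_succ]
  | _, cons f p => by
    rw [tr, ev, ev, ev_tr p, Layer.mor_tr, C.tr_comp _ _ _ (by rw [f.dom_mor, cod_ev])]

/-- Concatenation of paths. -/
@[reducible] def append {a b c : ℕ} (p : Path P b c) (q : Path P a b) : Path P a c :=
  match p with
  | nil => q
  | cons f p => cons f (p.append q)

theorem ev_append {a b : ℕ} : {c : ℕ} → (p : Path P b c) → (q : Path P a b) →
    (p.append q).ev = C.comp p.ev q.ev
  | _, nil, q => by rw [append, ev, C.one_comp_of_cod (by simp)]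
  | _, cons f p, q => by
    rw [append, ev, ev, ev_append p q, C.comp_assoc _ _ _ (by rw [f.dom_mor, cod_ev]) (by simp)]

end Path

namespace Ctx
variable {a b c d : ℕ}

/-- The composite of a context. -/
def ev {b d : ℕ} (L : Ctx P b d) : C.Mor :=
  match L with
  | nil => C.one (P.X ^ b)
  | cons f L => C.comp L.ev f.mor

theorem cod_ev_dom_ev : {b d : ℕ} → (L : Ctx P b d) →
    C.cod L.ev = P.X ^ d ∧ C.dom L.ev = P.X ^ b
  | _, _, nil => ⟨by rw [ev, C.cod_one], by rw [ev, C.dom_one]⟩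
  | _, _, cons f L => by
    have h : C.dom L.ev = C.cod f.mor := by rw [f.cod_mor, (cod_ev_dom_ev L).2]
    exact ⟨by rw [ev, C.cod_comp _ _ h, (cod_ev_dom_ev L).1],
      by rw [ev, C.dom_comp _ _ h, f.dom_mor]⟩

@[simp] theorem cod_ev (L : Ctx P b d) : C.cod L.ev = P.X ^ d := L.cod_ev_dom_ev.1
@[simp] theorem dom_ev (L : Ctx P b d) : C.dom L.ev = P.X ^ b := L.cod_ev_dom_ev.2

/-- `id_X ⊗ L`. -/
@[reducible] def tl {b d : ℕ} (L : Ctx P b d) : Ctx P (b + 1) (d + 1) :=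
  match L with
  | nil => nil
  | cons f L => cons f.tl L.tl

/-- `L ⊗ id_X`. -/
@[reducible] def tr {b d : ℕ} (L : Ctx P b d) : Ctx P (b + 1) (d + 1) :=
  match L with
  | nil => nil
  | cons f L => cons f.tr L.tr

theorem ev_tl : {b d : ℕ} → (L : Ctx P b d) → L.tl.ev = C.tl P.X L.ev
  | _, _, nil => by rw [tl, ev, ev, C.tl_one, pow_succ']
  | _, _, cons f L => by
    rw [tl, ev, ev, ev_tl L, Layer.mor_tl, C.tl_comp _ _ _ (by rw [f.cod_mor, dom_ev])]

theorem ev_tr : {b d : ℕ} → (L : Ctx P b d) → L.tr.ev = C.tr L.ev P.X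
  | _, _, nil => by rw [tr, ev, ev, C.tr_one, pow_succ]
  | _, _, cons f L => by
    rw [tr, ev, ev, ev_tr L, Layer.mor_tr, C.tr_comp _ _ _ (by rw [f.cod_mor, dom_ev])]

/-- The path obtained by filling the position of a context with a path. -/
@[reducible] def plug {a b d : ℕ} (L : Ctx P b d) (p : Path P a b) : Path P a d :=
  match L with
  | nil => p
  | cons f L => L.plug (Path.cons f p)

theorem ev_plug : {b : ℕ} → (L : Ctx P b d) → (p : Path P a b) →
    (L.plug p).ev = C.comp L.ev p.ev
  | _, nil, p => by rw [plug, ev, C.one_comp_of_cod (by simp)]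
  | _, cons f L, p => by
    rw [plug, ev, ev_plug L, Path.ev,
      C.comp_assoc _ _ _ (by rw [f.cod_mor, dom_ev]) (by rw [f.dom_mor, Path.cod_ev])]

/-- Extend a context by the layers of a path. -/
@[reducible] def push {b c d : ℕ} (p : Path P b c) (L : Ctx P c d) : Ctx P b d :=
  match p with
  | Path.nil => L
  | Path.cons f p => push p (cons f L)

theorem ev_push {b : ℕ} : {c : ℕ} → (p : Path P b c) → (L : Ctx P c d) →
    (push p L).ev = C.comp L.ev p.ev
  | _, Path.nil, L => by rw [push, Path.ev, C.comp_one_of_dom (by simp)]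
  | _, Path.cons f p, L => by
    rw [push, ev_push p, ev, Path.ev,
      C.comp_assoc _ _ _ (by rw [f.cod_mor, dom_ev]) (by rw [f.dom_mor, Path.cod_ev])]

/-- Concatenation of contexts. -/
@[reducible] def append {b c d : ℕ} (K : Ctx P b c) (L : Ctx P c d) : Ctx P b d :=
  match K with
  | nil => L
  | cons f K => cons f (K.append L)

theorem ev_append : {b c : ℕ} → (K : Ctx P b c) → (L : Ctx P c d) →
    (K.append L).ev = C.comp L.ev K.ev
  | _, _, nil, L => by rw [append, ev, C.comp_one_of_dom (by simp)]
  | _, _, cons f K, L => by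
    rw [append, ev, ev, ev_append K L, C.comp_assoc _ _ _ (by simp) (by rw [f.cod_mor, dom_ev])]

end Ctx

/-- A 2-morphism with prescribed source and target paths. -/
structure TwoCell {n m : ℕ} (s t : Path P n m) where
  cell : C.Cell
  src_cell : C.src cell = s.ev
  tgt_cell : C.tgt cell = t.ev

namespace TwoCell
variable {n m b c d : ℕ} {s t u : Path P n m}

attribute [simp] src_cell tgt_cell

theorem ext' {a b : TwoCell s t} (h : a.cell = b.cell) : a = b := by
  cases a; cases b; cases h; rfl

/-- The identity 2-morphism. -/
def id (s : Path P n m) : TwoCell s s := ⟨C.idc s.ev, C.src_idc _, C.tgt_idc _⟩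

/-- Vertical composition. -/
def comp (a : TwoCell s t) (b : TwoCell t u) : TwoCell s u :=
  ⟨C.vcomp a.cell b.cell, by rw [C.src_vcomp _ _ (by simp), src_cell],
    by rw [C.tgt_vcomp _ _ (by simp), tgt_cell]⟩

/-- `id_X ⊗ a`. -/
def tl (a : TwoCell s t) : TwoCell s.tl t.tl :=
  ⟨C.tl₂ P.X a.cell, by rw [C.src_tl₂, src_cell, Path.ev_tl],
    by rw [C.tgt_tl₂, tgt_cell, Path.ev_tl]⟩

/-- `a ⊗ id_X`. -/
def tr (a : TwoCell s t) : TwoCell s.tr t.tr :=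
  ⟨C.tr₂ a.cell P.X, by rw [C.src_tr₂, src_cell, Path.ev_tr],
    by rw [C.tgt_tr₂, tgt_cell, Path.ev_tr]⟩

theorem dom_src (a : TwoCell s t) : C.dom (C.src a.cell) = P.X ^ n := by simp
theorem cod_src (a : TwoCell s t) : C.cod (C.src a.cell) = P.X ^ m := by simp

/-- The 2-morphism `a` in the position given by a context `L` and a path `R`. -/
def wh (L : Ctx P m d) (a : TwoCell s t) (R : Path P b n) :
    TwoCell (L.plug (s.append R)) (L.plug (t.append R)) :=
  ⟨C.hcomp (C.idc L.ev) (C.hcomp a.cell (C.idc R.ev)), by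
    have h : C.dom (C.src a.cell) = C.cod (C.src (C.idc R.ev)) := by simp [C.src_idc]
    rw [C.src_hcomp _ _ ?_, C.src_hcomp _ _ h, C.src_idc, C.src_idc, src_cell, Ctx.ev_plug,
      Path.ev_append]
    rw [C.src_hcomp _ _ h, C.src_idc, C.src_idc, src_cell, C.cod_comp _ _ (by simp)]; simp, by
    have h : C.dom (C.src a.cell) = C.cod (C.src (C.idc R.ev)) := by simp [C.src_idc]
    rw [C.tgt_hcomp _ _ ?_, C.tgt_hcomp _ _ h, C.tgt_idc, C.tgt_idc, tgt_cell, Ctx.ev_plug,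
      Path.ev_append]
    rw [C.src_hcomp _ _ h, C.src_idc, C.src_idc, src_cell, C.cod_comp _ _ (by simp)]; simp⟩

end TwoCell

/-- Partially defined vertical composites: 2-morphisms together with an element `none` that stands
for "not composable". -/
def Diag (C : QuasistrictSymmMonoidal2Cat) := Option C.Cell

namespace Diag
open Classical in
noncomputable instance : Mul (Diag C) :=
  ⟨fun x y => Option.bind x fun a => Option.bind y fun b =>
    if C.tgt a = C.src b then some (C.vcomp a b) else none⟩

/-- A 2-morphism as a diagram. -/
def of (a : C.Cell) : Diag C := some a

/-- The undefined diagram. -/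
def undef : Diag C := (none : Option C.Cell)

theorem of_injective {a b : C.Cell} (h : of a = of b) : a = b := Option.some.inj h

theorem of_mul_of {a b : C.Cell} (h : C.tgt a = C.src b) : of a * of b = of (C.vcomp a b) :=
  if_pos h

theorem of_mul_of_neg {a b : C.Cell} (h : ¬ C.tgt a = C.src b) :
    of a * of b = undef :=
  if_neg h

theorem none_mul (x : Diag C) : undef * x = undef := rfl
theorem mul_none (x : Diag C) : x * undef = undef := by
  cases x <;> rfl

/-- Adjoining a value for undefined composites makes vertical composition associative without
side conditions. -/
noncomputable instance : Semigroup (Diag C) where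
  mul_assoc x y z := by
    rcases x with _ | a
    · rfl
    rcases y with _ | b
    · rfl
    rcases z with _ | c
    · change of a * of b * undef = of a * (of b * undef)
      simp only [mul_none]
    change of a * of b * of c = of a * (of b * of c)
    by_cases h : C.tgt a = C.src b <;> by_cases h' : C.tgt b = C.src c
    · rw [of_mul_of h, of_mul_of h', of_mul_of, of_mul_of, C.vcomp_assoc _ _ _ h h']
      · rw [C.src_vcomp _ _ h', h]
      · rw [C.tgt_vcomp _ _ h, h']
    · rw [of_mul_of h, of_mul_of_neg h', mul_none, of_mul_of_neg]
      rwa [C.tgt_vcomp _ _ h]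
    · rw [of_mul_of_neg h, of_mul_of h', none_mul, of_mul_of_neg]
      rwa [C.src_vcomp _ _ h']
    · rw [of_mul_of_neg h, of_mul_of_neg h', none_mul, mul_none]

end Diag

section Slice
variable {n m b c d d' b' : ℕ} {s t u : Path P n m}

/-- The 2-morphism `a` whiskered by the layers of `L` after it and those of `R` before it. -/
def slice (L : Ctx P m d) (a : TwoCell s t) (R : Path P b n) : Diag C :=
  Diag.of (a.wh L R).cell

/-- The identity of a path. -/
def idd (p : Path P n m) : Diag C := Diag.of (C.idc p.ev)

theorem slice_nil (a : TwoCell s t) : slice .nil a .nil = Diag.of a.cell := by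
  simp only [slice, TwoCell.wh, Ctx.ev, Path.ev]
  rw [C.hcomp_one_of_dom a.dom_src, C.one_hcomp_of_cod a.cod_src]

theorem TwoCell.ext_slice {a b : TwoCell s t}
    (h : slice .nil a .nil = slice .nil b .nil) : a = b := by
  rw [slice_nil, slice_nil] at h
  exact TwoCell.ext' (Diag.of_injective h)

theorem slice_comp (L : Ctx P m d) (a : TwoCell s t) (a' : TwoCell t u) (R : Path P b n) :
    slice L (a.comp a') R = slice L a R * slice L a' R := by
  rw [slice, slice, slice, Diag.of_mul_of (by simp)]
  congr 1
  simp only [TwoCell.wh, TwoCell.comp]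
  have e : ∀ f : C.Mor, C.idc f = C.vcomp (C.idc f) (C.idc f) := fun f =>
    (C.idc_vcomp_of_src (C.src_idc _)).symm
  have h : ∀ {s t : Path P n m} (a : TwoCell s t),
      C.dom (C.src a.cell) = C.cod (C.src (C.idc R.ev)) := fun a => by simp [C.src_idc]
  rw [e R.ev, C.hcomp_vcomp _ _ _ _ (by simp [C.src_idc, C.tgt_idc]) (by simp) (h a), ← e R.ev,
    e L.ev, C.hcomp_vcomp _ _ _ _ ?_ (by simp [C.src_idc, C.tgt_idc]) ?_, ← e L.ev]
  · rw [C.tgt_hcomp _ _ (h a), C.src_hcomp _ _ (h a')]; simp [C.src_idc, C.tgt_idc]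
  · rw [C.src_hcomp _ _ (h a), C.src_idc, C.src_idc, a.src_cell, C.cod_comp _ _ (by simp)]; simp

theorem slice_id (L : Ctx P m d) (s : Path P n m) (R : Path P b n) :
    slice L (TwoCell.id s) R = idd (L.plug (s.append R)) := by
  rw [slice, idd]
  simp only [TwoCell.wh, TwoCell.id]
  rw [C.hcomp_idc _ _ (by simp), C.hcomp_idc _ _ ?_, Ctx.ev_plug, Path.ev_append]
  rw [C.cod_comp _ _ (by simp)]; simp

theorem idd_mul_slice {p : Path P b d} {L : Ctx P m d} {a : TwoCell s t} {R : Path P b n}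
    (h : p = L.plug (s.append R)) : idd p * slice L a R = slice L a R := by
  subst h
  rw [idd, slice, Diag.of_mul_of (by simp [C.tgt_idc]), C.idc_vcomp_of_src (by simp)]

theorem slice_mul_idd {p : Path P b d} {L : Ctx P m d} {a : TwoCell s t} {R : Path P b n}
    (h : p = L.plug (t.append R)) : slice L a R * idd p = slice L a R := by
  subst h
  rw [idd, slice, Diag.of_mul_of (by simp [C.src_idc]), C.vcomp_idc_of_tgt (by simp)]

theorem idd_mul_slice_mul {p : Path P b d} {L : Ctx P m d} {a : TwoCell s t} {R : Path P b n}
    (k : Diag C) (h : p = L.plug (s.append R)) :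
    idd p * (slice L a R * k) = slice L a R * k := by
  rw [← mul_assoc, idd_mul_slice h]

theorem slice_wh {L' : Ctx P d d'} {L : Ctx P m d} {a : TwoCell s t} {R : Path P b n}
    {R' : Path P b' b} :
    slice L' (a.wh L R) R' = slice (L.append L') a (R.append R') := by
  rw [slice, slice]
  congr 1
  have h : C.dom (C.src a.cell) = C.cod R.ev := by simp
  simp only [TwoCell.wh, Ctx.ev_append, Path.ev_append]
  have h1 : C.src (C.hcomp a.cell (C.idc R.ev)) = C.comp s.ev R.ev := by
    rw [C.src_hcomp _ _ (by simp [C.src_idc]), C.src_idc, a.src_cell]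
  have h2 : C.src (C.hcomp (C.idc R.ev) (C.idc R'.ev)) = C.comp R.ev R'.ev := by
    rw [C.hcomp_idc _ _ (by simp), C.src_idc]
  have h3 : C.src (C.hcomp a.cell (C.hcomp (C.idc R.ev) (C.idc R'.ev))) =
      C.comp s.ev (C.comp R.ev R'.ev) := by
    rw [C.src_hcomp _ _, h2, a.src_cell]
    rw [h2, C.cod_comp _ _ (by simp)]; simp
  rw [← C.hcomp_idc _ _ (by simp), ← C.hcomp_idc _ _ (by simp), C.hcomp_assoc, C.hcomp_assoc,
    C.hcomp_assoc]
  · simp [C.src_idc]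
  · rw [h3, C.cod_comp _ _ (by rw [C.cod_comp _ _ (by simp)]; simp)]; simp [C.src_idc]
  · simp [C.src_idc]
  · simp [C.src_idc]
  · rw [C.src_idc, h1, C.cod_comp _ _ (by simp)]; simp
  · rw [h1, C.dom_comp _ _ (by simp)]; simp [C.src_idc]

theorem tl_comp (a : TwoCell s t) (a' : TwoCell t u) : (a.comp a').tl = a.tl.comp a'.tl :=
  TwoCell.ext' (C.tl₂_vcomp _ _ _ (by simp))

theorem tr_comp (a : TwoCell s t) (a' : TwoCell t u) : (a.comp a').tr = a.tr.comp a'.tr :=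
  TwoCell.ext' (C.tr₂_vcomp _ _ _ (by simp))

theorem slice_tl_wh {L' : Ctx P (d + 1) d'} {L : Ctx P m d} {a : TwoCell s t} {R : Path P b n}
    {R' : Path P b' (b + 1)} :
    slice L' (a.wh L R).tl R' = slice (L.tl.append L') a.tl (R.tl.append R') := by
  rw [← slice_wh, slice, slice]
  congr 1
  simp only [TwoCell.wh, TwoCell.tl]
  have h1 : C.src (C.hcomp a.cell (C.idc R.ev)) = C.comp s.ev R.ev := by
    rw [C.src_hcomp _ _ (by simp [C.src_idc]), C.src_idc, a.src_cell]
  rw [C.tl₂_hcomp, C.tl₂_hcomp, C.tl₂_idc, C.tl₂_idc, Ctx.ev_tl, Path.ev_tl]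
  · simp [C.src_idc]
  · rw [C.src_idc, h1, C.cod_comp _ _ (by simp)]; simp

theorem slice_tr_wh {L' : Ctx P (d + 1) d'} {L : Ctx P m d} {a : TwoCell s t} {R : Path P b n}
    {R' : Path P b' (b + 1)} :
    slice L' (a.wh L R).tr R' = slice (L.tr.append L') a.tr (R.tr.append R') := by
  rw [← slice_wh, slice, slice]
  congr 1
  simp only [TwoCell.wh, TwoCell.tr]
  have h1 : C.src (C.hcomp a.cell (C.idc R.ev)) = C.comp s.ev R.ev := by
    rw [C.src_hcomp _ _ (by simp [C.src_idc]), C.src_idc, a.src_cell]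
  rw [C.tr₂_hcomp, C.tr₂_hcomp, C.tr₂_idc, C.tr₂_idc, Ctx.ev_tr, Path.ev_tr]
  · simp [C.src_idc]
  · rw [C.src_idc, h1, C.cod_comp _ _ (by simp)]; simp

theorem slice_tl_tr (L : Ctx P (m + 1 + 1) d) (a : TwoCell s t) (R : Path P b (n + 1 + 1)) :
    slice L a.tl.tr R = slice L a.tr.tl R := by
  simp only [slice, TwoCell.wh, TwoCell.tl, TwoCell.tr, C.tr₂_tl₂]

theorem tl_id (s : Path P n m) : (TwoCell.id s).tl = TwoCell.id s.tl :=
  TwoCell.ext' (by simp only [TwoCell.tl, TwoCell.id]; rw [C.tl₂_idc, Path.ev_tl])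

theorem tr_id (s : Path P n m) : (TwoCell.id s).tr = TwoCell.id s.tr :=
  TwoCell.ext' (by simp only [TwoCell.tr, TwoCell.id]; rw [C.tr₂_idc, Path.ev_tr])

end Slice

section Exchange
variable {n m b c d : ℕ} {s t : Path P n m}

/-- The interchange law: 2-morphisms acting on disjoint parts of a composite commute. Here `a` acts
to the left of `a'`, and the layers of `mid` lie between them. The positions after and before are
variables, determined by the last two hypotheses. -/
theorem exch {k l : ℕ} {s' t' : Path P k l} (a : TwoCell s t) (a' : TwoCell s' t')
    (mid : Path P l n) {L : Ctx P m d} {R : Path P b k} {R₁ : Path P b n} {L₂ : Ctx P l d}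
    (h₁ : R₁ = mid.append (s'.append R)) (h₂ : L₂ = Ctx.push (t.append mid) L) :
    slice L a R₁ * slice L₂ a' R =
      slice (Ctx.push (s.append mid) L) a' R * slice L a (mid.append (t'.append R)) := by
  subst h₁ h₂
  set y : C.Cell := C.hcomp (C.idc mid.ev) (C.hcomp a'.cell (C.idc R.ev)) with hy
  have hya : C.dom (C.src a'.cell) = C.cod (C.src (C.idc R.ev)) := by simp [C.src_idc]
  have hs0 : C.src (C.hcomp a'.cell (C.idc R.ev)) = C.comp s'.ev R.ev := by
    rw [C.src_hcomp _ _ hya, C.src_idc, a'.src_cell]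
  have ht0 : C.tgt (C.hcomp a'.cell (C.idc R.ev)) = C.comp t'.ev R.ev := by
    rw [C.tgt_hcomp _ _ hya, C.tgt_idc, a'.tgt_cell]
  have hy0 : C.dom (C.src (C.idc mid.ev)) = C.cod (C.src (C.hcomp a'.cell (C.idc R.ev))) := by
    rw [hs0, C.cod_comp _ _ (by simp), C.src_idc]; simp
  have hs : C.src y = (mid.append (s'.append R)).ev := by
    rw [hy, C.src_hcomp _ _ hy0, hs0, C.src_idc, Path.ev_append, Path.ev_append]
  have ht : C.tgt y = (mid.append (t'.append R)).ev := by
    rw [hy, C.tgt_hcomp _ _ hy0, ht0, C.tgt_idc, Path.ev_append, Path.ev_append]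
  have key : ∀ r : Path P n m, slice (Ctx.push (r.append mid) L) a' R =
      Diag.of (C.hcomp (C.idc L.ev) (C.hcomp (C.idc r.ev) y)) := fun r => by
    rw [slice]
    congr 1
    simp only [TwoCell.wh, Ctx.ev_push, Path.ev_append]
    have hh : C.cod (C.comp r.ev mid.ev) = P.X ^ m := by rw [C.cod_comp _ _ (by simp)]; simp
    have hd : C.dom (C.comp r.ev mid.ev) = P.X ^ l := by rw [C.dom_comp _ _ (by simp)]; simp
    rw [← C.hcomp_idc _ _ (by rw [hh]; simp), ← C.hcomp_idc _ _ (by simp), hy, C.hcomp_assoc,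
      C.hcomp_assoc]
    · rw [C.src_idc, C.src_idc]; simp
    · exact hy0
    · rw [C.hcomp_idc _ _ (by simp), C.src_idc, C.src_idc, hh]; simp
    · rw [C.hcomp_idc _ _ (by simp), C.src_idc, hd, hs0, C.cod_comp _ _ (by simp)]; simp
  have hsy : C.cod (C.src y) = P.X ^ n := by rw [hs]; simp
  have hty : C.cod (C.tgt y) = P.X ^ n := by rw [ht]; simp
  have e : ∀ f : C.Mor, C.vcomp (C.idc f) (C.idc f) = C.idc f := fun f =>
    C.idc_vcomp_of_src (C.src_idc _)
  have hL : ∀ (r : Path P n m) (f : C.Mor), C.cod f = P.X ^ n →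
      C.dom (C.src (C.idc L.ev)) = C.cod (C.comp r.ev f) := fun r f hf => by
    rw [C.cod_comp _ _ (by simp [hf]), C.src_idc]; simp
  have s1 : ∀ p : Path P b n, C.src (C.hcomp a.cell (C.idc p.ev)) = C.comp s.ev p.ev := fun p => by
    rw [C.src_hcomp _ _ (by simp [C.src_idc]), C.src_idc, a.src_cell]
  have t1 : ∀ p : Path P b n, C.tgt (C.hcomp a.cell (C.idc p.ev)) = C.comp t.ev p.ev := fun p => by
    rw [C.tgt_hcomp _ _ (by simp [C.src_idc]), C.tgt_idc, a.tgt_cell]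
  have s2 : ∀ r : Path P n m, C.src (C.hcomp (C.idc r.ev) y) = C.comp r.ev (C.src y) := fun r => by
    rw [C.src_hcomp _ _ (by simp [C.src_idc, hsy]), C.src_idc]
  have t2 : ∀ r : Path P n m, C.tgt (C.hcomp (C.idc r.ev) y) = C.comp r.ev (C.tgt y) := fun r => by
    rw [C.tgt_hcomp _ _ (by simp [C.src_idc, hsy]), C.tgt_idc]
  rw [key, key, slice, slice, Diag.of_mul_of, Diag.of_mul_of]
  · congr 1
    simp only [TwoCell.wh]
    have hi : ∀ {f g : C.Mor}, f = g → C.tgt (C.idc f) = C.src (C.idc g) := fun h => by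
      rw [C.tgt_idc, C.src_idc, h]
    rw [← C.hcomp_vcomp (C.idc L.ev) (C.idc L.ev) _ _ (by rw [t1, s2, hs]) (hi rfl)
        (by rw [s1]; exact hL _ _ (by simp)),
      ← C.hcomp_vcomp (C.idc L.ev) (C.idc L.ev) _ _ (by rw [t2, s1, ht]) (hi rfl)
        (by rw [s2]; exact hL _ _ hsy), e,
      ← C.hcomp_vcomp _ _ _ _ (by rw [C.tgt_idc, hs]) (by rw [a.tgt_cell, C.src_idc])
        (by rw [a.src_cell, C.src_idc]; simp),
      ← C.hcomp_vcomp _ _ _ _ (by rw [ht, C.src_idc]) (by rw [C.tgt_idc, a.src_cell])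
        (by rw [C.src_idc, hsy]; simp),
      C.idc_vcomp_of_src hs, C.vcomp_idc_of_tgt a.tgt_cell, C.vcomp_idc_of_tgt ht,
      C.idc_vcomp_of_src a.src_cell]
  · rw [C.tgt_hcomp _ _ (by rw [s2]; exact hL _ _ hsy), t2, TwoCell.wh,
      C.src_hcomp _ _ (by rw [s1]; exact hL _ _ (by simp)), s1, ht, C.src_idc, C.tgt_idc]
  · rw [C.src_hcomp _ _ (by rw [s2]; exact hL _ _ hsy), s2, TwoCell.wh,
      C.tgt_hcomp _ _ (by rw [s1]; exact hL _ _ (by simp)), t1, hs, C.src_idc, C.tgt_idc]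

theorem exch_assoc {k l : ℕ} {s' t' : Path P k l} (a : TwoCell s t) (a' : TwoCell s' t')
    (mid : Path P l n) {L : Ctx P m d} {R : Path P b k} {R₁ : Path P b n} {L₂ : Ctx P l d}
    (h₁ : R₁ = mid.append (s'.append R)) (h₂ : L₂ = Ctx.push (t.append mid) L) (x : Diag C) :
    slice L a R₁ * (slice L₂ a' R * x) =
      slice (Ctx.push (s.append mid) L) a' R * (slice L a (mid.append (t'.append R)) * x) := by
  rw [← mul_assoc, exch a a' mid h₁ h₂, mul_assoc]

end Exchange

section Assoc
variable {w x y z x' y' z' : Diag C}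

theorem mul_mul_of_eq (h : x * y = z) (k : Diag C) : x * (y * k) = z * k := by
  rw [← mul_assoc, h]

theorem mul_mul_mul_of_eq (h : w * (x * y) = z) (k : Diag C) : w * (x * (y * k)) = z * k := by
  rw [← h, mul_assoc, mul_assoc]

end Assoc

end RibbonData

/-! ### The generators and relations as rewriting rules -/

namespace RibbonData

open QuasistrictSymmMonoidal2Cat

variable {C : QuasistrictSymmMonoidal2Cat} {P : RibbonData C}

/-- `f ⊳ p` is the path `p` followed by the layer `f`. -/
infixr:67 " ⊳ " => Path.cons
/-- `f ⊲ L` is the context `L` with the layer `f` added next to the position. -/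
infixr:67 " ⊲ " => Ctx.cons

theorem Path.ev_nil {n : ℕ} : (Path.nil : Path P n n).ev = C.one (P.X ^ n) := by rw [Path.ev]

theorem Path.ev_singleton {n m : ℕ} (f : Layer P n m) : (f ⊳ .nil).ev = f.mor := by
  rw [Path.ev, Path.ev, C.comp_one_of_dom f.dom_mor]

theorem Path.ev_cons {n m k : ℕ} (f : Layer P m k) (p : Path P n m) :
    (f ⊳ p).ev = C.comp f.mor p.ev := by
  rw [Path.ev]

theorem Path.ev_pair {n m k : ℕ} (f : Layer P m k) (g : Layer P n m) :
    (f ⊳ g ⊳ .nil).ev = C.comp f.mor g.mor := by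
  rw [Path.ev, Path.ev_singleton]

theorem Ctx.ev_singleton {n m : ℕ} (f : Layer P n m) : (f ⊲ .nil).ev = f.mor := by
  rw [Ctx.ev, Ctx.ev, C.one_comp_of_cod f.cod_mor]

theorem Ctx.ev_pair {n m k : ℕ} (f : Layer P m k) (g : Layer P n m) :
    (g ⊲ f ⊲ .nil).ev = C.comp f.mor g.mor := by
  rw [Ctx.ev, Ctx.ev_singleton]

section Generators
variable (P)

/-- The pair of pants. -/
def LM : Layer P 2 1 := .ofMor P.M (by rw [P.dom_M, pow_two]) (by rw [P.cod_M, pow_one])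
/-- The copants. -/
def LD : Layer P 1 2 := .ofMor P.D (by rw [P.dom_D, pow_one]) (by rw [P.cod_D, pow_two])
/-- The cup. -/
def Lu : Layer P 0 1 := .ofMor P.u (by rw [P.dom_u, pow_zero]) (by rw [P.cod_u, pow_one])
/-- The cap. -/
def Le : Layer P 1 0 := .ofMor P.e (by rw [P.dom_e, pow_one]) (by rw [P.cod_e, pow_zero])

theorem mor_LM : (LM P).mor = P.M := Layer.mor_ofMor _ _ _
theorem mor_LD : (LD P).mor = P.D := Layer.mor_ofMor _ _ _
theorem mor_Lu : (Lu P).mor = P.u := Layer.mor_ofMor _ _ _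
theorem mor_Le : (Le P).mor = P.e := Layer.mor_ofMor _ _ _

end Generators

local notation "𝗠" => LM _
local notation "𝗗" => LD _
local notation "𝘂" => Lu _
local notation "𝗲" => Le _

section Cells
variable (P)

/-- The associator. -/
def cα : TwoCell (P := P) (𝗠 ⊳ (𝗠).tr ⊳ .nil) (𝗠 ⊳ (𝗠).tl ⊳ .nil) :=
  ⟨P.α, by rw [P.src_α, Path.ev_pair, Layer.mor_tr, mor_LM],
    by rw [P.tgt_α, Path.ev_pair, Layer.mor_tl, mor_LM]⟩

/-- The inverse of the associator. -/
def cαi : TwoCell (P := P) (𝗠 ⊳ (𝗠).tl ⊳ .nil) (𝗠 ⊳ (𝗠).tr ⊳ .nil) :=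
  ⟨P.αi, by rw [P.src_αi, Path.ev_pair, Layer.mor_tl, mor_LM],
    by rw [P.tgt_αi, Path.ev_pair, Layer.mor_tr, mor_LM]⟩

/-- The right unitor. -/
def cρ : TwoCell (P := P) (𝗠 ⊳ (𝘂).tl ⊳ .nil) .nil :=
  ⟨P.ρ, by rw [P.src_ρ, Path.ev_pair, Layer.mor_tl, mor_LM, mor_Lu],
    by rw [P.tgt_ρ, Path.ev_nil, pow_one]⟩

/-- The inverse of the right unitor. -/
def cρi : TwoCell (P := P) .nil (𝗠 ⊳ (𝘂).tl ⊳ .nil) :=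
  ⟨P.ρi, by rw [P.src_ρi, Path.ev_nil, pow_one],
    by rw [P.tgt_ρi, Path.ev_pair, Layer.mor_tl, mor_LM, mor_Lu]⟩

/-- The left unitor. -/
def cl : TwoCell (P := P) (𝗠 ⊳ (𝘂).tr ⊳ .nil) .nil :=
  ⟨P.lam, by rw [P.src_lam, Path.ev_pair, Layer.mor_tr, mor_LM, mor_Lu],
    by rw [P.tgt_lam, Path.ev_nil, pow_one]⟩

/-- The inverse of the left unitor. -/
def cli : TwoCell (P := P) .nil (𝗠 ⊳ (𝘂).tr ⊳ .nil) :=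
  ⟨P.lami, by rw [P.src_lami, Path.ev_nil, pow_one],
    by rw [P.tgt_lami, Path.ev_pair, Layer.mor_tr, mor_LM, mor_Lu]⟩

/-- The twist. -/
def cθ : TwoCell (P := P) (n := 1) .nil .nil :=
  ⟨P.θ, by rw [P.src_θ, Path.ev_nil, pow_one], by rw [P.tgt_θ, Path.ev_nil, pow_one]⟩

/-- The inverse of the twist. -/
def cθi : TwoCell (P := P) (n := 1) .nil .nil :=
  ⟨P.θi, by rw [P.src_θi, Path.ev_nil, pow_one], by rw [P.tgt_θi, Path.ev_nil, pow_one]⟩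

/-- The unit of `M ⊣ D`. -/
def cη : TwoCell (P := P) .nil (𝗗 ⊳ 𝗠 ⊳ .nil) :=
  ⟨P.η, by rw [P.src_η, Path.ev_nil, pow_two],
    by rw [P.tgt_η, Path.ev_pair, mor_LD, mor_LM]⟩

/-- The counit of `D ⊣ M`. -/
def cηd : TwoCell (P := P) (𝗗 ⊳ 𝗠 ⊳ .nil) .nil :=
  ⟨P.ηd, by rw [P.src_ηd, Path.ev_pair, mor_LD, mor_LM],
    by rw [P.tgt_ηd, Path.ev_nil, pow_two]⟩

/-- The counit of `M ⊣ D`. -/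
def cε : TwoCell (P := P) (𝗠 ⊳ 𝗗 ⊳ .nil) .nil :=
  ⟨P.ε, by rw [P.src_ε, Path.ev_pair, mor_LD, mor_LM],
    by rw [P.tgt_ε, Path.ev_nil, pow_one]⟩

/-- The unit of `D ⊣ M`, which opens a hole in a cylinder. -/
def cεd : TwoCell (P := P) .nil (𝗠 ⊳ 𝗗 ⊳ .nil) :=
  ⟨P.εd, by rw [P.src_εd, Path.ev_nil, pow_one],
    by rw [P.tgt_εd, Path.ev_pair, mor_LD, mor_LM]⟩

/-- The unit of `u ⊣ e`. -/
def cν : TwoCell (P := P) .nil (𝗲 ⊳ 𝘂 ⊳ .nil) :=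
  ⟨P.ν, by rw [P.src_ν, Path.ev_nil, pow_zero],
    by rw [P.tgt_ν, Path.ev_pair, mor_Le, mor_Lu]⟩

/-- The counit of `u ⊣ e`. -/
def cμ : TwoCell (P := P) (𝘂 ⊳ 𝗲 ⊳ .nil) .nil :=
  ⟨P.μ, by rw [P.src_μ, Path.ev_pair, mor_Le, mor_Lu],
    by rw [P.tgt_μ, Path.ev_nil, pow_one]⟩

/-- The unit of `e ⊣ u`. -/
def cμd : TwoCell (P := P) .nil (𝘂 ⊳ 𝗲 ⊳ .nil) :=
  ⟨P.μd, by rw [P.src_μd, Path.ev_nil, pow_one],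
    by rw [P.tgt_μd, Path.ev_pair, mor_Le, mor_Lu]⟩

theorem mor_frobL : ((𝗠).tr ⊳ (𝗗).tl ⊳ .nil : Path P 2 2).ev = P.frobL := by
  rw [Path.ev_pair, Layer.mor_tr, Layer.mor_tl, mor_LM, mor_LD, frobL]

theorem mor_frobR : ((𝗠).tl ⊳ (𝗗).tr ⊳ .nil : Path P 2 2).ev = P.frobR := by
  rw [Path.ev_pair, Layer.mor_tr, Layer.mor_tl, mor_LM, mor_LD, frobR]

end Cells

section WhCell
variable {n m b d : ℕ} {s t : Path P n m}

theorem wh_nil_left (a : TwoCell s t) (R : Path P b n) :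
    (a.wh .nil R).cell = C.hcomp a.cell (C.idc R.ev) := by
  simp only [TwoCell.wh, Ctx.ev]
  rw [C.one_hcomp_of_cod]
  rw [C.src_hcomp _ _ (by simp [C.src_idc]), C.src_idc, a.src_cell, C.cod_comp _ _ (by simp)]
  simp

theorem wh_nil_right (L : Ctx P m d) (a : TwoCell s t) :
    (a.wh L .nil).cell = C.hcomp (C.idc L.ev) a.cell := by
  simp only [TwoCell.wh, Path.ev_nil]
  rw [C.hcomp_one_of_dom a.dom_src]

theorem wh_cons {k l : ℕ} (f : Layer P m k) (L : Ctx P k d) (a : TwoCell s t) (g : Layer P l n)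
    (R : Path P b l) : (a.wh (f ⊲ L) (g ⊳ R)).cell =
      C.hcomp (C.idc (f ⊲ L).ev) (C.hcomp a.cell (C.idc (g ⊳ R).ev)) := rfl

theorem comp_cell {u : Path P n m} (a : TwoCell s t) (a' : TwoCell t u) :
    (a.comp a').cell = C.vcomp a.cell a'.cell := rfl

theorem id_cell (s : Path P n m) : (TwoCell.id s).cell = C.idc s.ev := rfl
theorem tl_cell (a : TwoCell s t) : a.tl.cell = C.tl₂ P.X a.cell := rfl
theorem tr_cell (a : TwoCell s t) : a.tr.cell = C.tr₂ a.cell P.X := rfl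

end WhCell

/-- The left Frobeniusator. -/
def cφl (P : RibbonData C) : TwoCell (P := P) ((𝗠).tr ⊳ (𝗗).tl ⊳ .nil) (𝗗 ⊳ 𝗠 ⊳ .nil) :=
  ((cη P).wh .nil ((𝗠).tr ⊳ (𝗗).tl ⊳ .nil)).comp
    (((cα P).wh (𝗗 ⊲ .nil) ((𝗗).tl ⊳ .nil)).comp ((cε P).tl.wh (𝗠 ⊲ 𝗗 ⊲ .nil) .nil))

/-- The inverse of the left Frobeniusator. -/
def cφli (P : RibbonData C) : TwoCell (P := P) (𝗗 ⊳ 𝗠 ⊳ .nil) ((𝗠).tr ⊳ (𝗗).tl ⊳ .nil) :=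
  ((cεd P).tl.wh (𝗠 ⊲ 𝗗 ⊲ .nil) .nil).comp
    (((cαi P).wh (𝗗 ⊲ .nil) ((𝗗).tl ⊳ .nil)).comp ((cηd P).wh .nil ((𝗠).tr ⊳ (𝗗).tl ⊳ .nil)))

/-- The right Frobeniusator. -/
def cφr (P : RibbonData C) : TwoCell (P := P) ((𝗠).tl ⊳ (𝗗).tr ⊳ .nil) (𝗗 ⊳ 𝗠 ⊳ .nil) :=
  ((cη P).wh .nil ((𝗠).tl ⊳ (𝗗).tr ⊳ .nil)).comp
    (((cαi P).wh (𝗗 ⊲ .nil) ((𝗗).tr ⊳ .nil)).comp ((cε P).tr.wh (𝗠 ⊲ 𝗗 ⊲ .nil) .nil))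

/-- The inverse of the right Frobeniusator. -/
def cφri (P : RibbonData C) : TwoCell (P := P) (𝗗 ⊳ 𝗠 ⊳ .nil) ((𝗠).tl ⊳ (𝗗).tr ⊳ .nil) :=
  ((cεd P).tr.wh (𝗠 ⊲ 𝗗 ⊲ .nil) .nil).comp
    (((cα P).wh (𝗗 ⊲ .nil) ((𝗗).tr ⊳ .nil)).comp ((cηd P).wh .nil ((𝗠).tl ⊳ (𝗗).tr ⊳ .nil)))

theorem cell_cφl : (cφl P).cell = P.phiL := by
  simp only [cφl, comp_cell, wh_nil_left, wh_nil_right, wh_cons, mor_frobL, Ctx.ev_singleton,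
    Path.ev_singleton, Ctx.ev_pair, Layer.mor_tl, mor_LD, mor_LM, tl_cell]
  rfl

theorem cell_cφli : (cφli P).cell = P.phiLInv := by
  simp only [cφli, comp_cell, wh_nil_left, wh_nil_right, wh_cons, mor_frobL, Ctx.ev_singleton,
    Path.ev_singleton, Ctx.ev_pair, Layer.mor_tl, mor_LD, mor_LM, tl_cell]
  rfl

theorem cell_cφr : (cφr P).cell = P.phiR := by
  simp only [cφr, comp_cell, wh_nil_left, wh_nil_right, wh_cons, mor_frobR, Ctx.ev_singleton,
    Path.ev_singleton, Ctx.ev_pair, Layer.mor_tr, mor_LD, mor_LM, tr_cell]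
  rfl

theorem cell_cφri : (cφri P).cell = P.phiRInv := by
  simp only [cφri, comp_cell, wh_nil_left, wh_nil_right, wh_cons, mor_frobR, Ctx.ev_singleton,
    Path.ev_singleton, Ctx.ev_pair, Layer.mor_tr, mor_LD, mor_LM, tr_cell]
  rfl

section Lift
variable {n m b d : ℕ} {s t s' t' u : Path P n m}

theorem slice_congr {a a' : TwoCell s t} (h : a = a') (L : Ctx P m d) (R : Path P b n) :
    slice L a R = slice L a' R := by rw [h]

theorem slice_tl_congr {a a' : TwoCell s t} (h : a = a') (L : Ctx P (m + 1) d)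
    (R : Path P b (n + 1)) : slice L a.tl R = slice L a'.tl R := by rw [h]

theorem slice_tr_congr {a a' : TwoCell s t} (h : a = a') (L : Ctx P (m + 1) d)
    (R : Path P b (n + 1)) : slice L a.tr R = slice L a'.tr R := by rw [h]

theorem slice_inv {a : TwoCell s t} {a' : TwoCell t s} (h : a.comp a' = TwoCell.id s)
    (L : Ctx P m d) (R : Path P b n) : slice L a R * slice L a' R = idd (L.plug (s.append R)) := by
  rw [← slice_comp, h, slice_id]

theorem slice_inv_tl {a : TwoCell s t} {a' : TwoCell t s} (h : a.comp a' = TwoCell.id s)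
    (L : Ctx P (m + 1) d) (R : Path P b (n + 1)) :
    slice L a.tl R * slice L a'.tl R = idd (L.plug (s.tl.append R)) := by
  rw [← slice_comp, ← tl_comp, h, tl_id, slice_id]

theorem slice_inv_tr {a : TwoCell s t} {a' : TwoCell t s} (h : a.comp a' = TwoCell.id s)
    (L : Ctx P (m + 1) d) (R : Path P b (n + 1)) :
    slice L a.tr R * slice L a'.tr R = idd (L.plug (s.tr.append R)) := by
  rw [← slice_comp, ← tr_comp, h, tr_id, slice_id]

end Lift

section Axioms

theorem cα_cαi (hP : P.IsRibbonObject) : (cα P).comp (cαi P) = TwoCell.id _ :=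
  TwoCell.ext' (by
    rw [comp_cell, id_cell, Path.ev_pair, Layer.mor_tr, mor_LM]; exact hP.inverses.α_αi)

theorem cαi_cα (hP : P.IsRibbonObject) : (cαi P).comp (cα P) = TwoCell.id _ :=
  TwoCell.ext' (by
    rw [comp_cell, id_cell, Path.ev_pair, Layer.mor_tl, mor_LM]; exact hP.inverses.αi_α)

theorem cρ_cρi (hP : P.IsRibbonObject) : (cρ P).comp (cρi P) = TwoCell.id _ :=
  TwoCell.ext' (by
    rw [comp_cell, id_cell, Path.ev_pair, Layer.mor_tl, mor_LM, mor_Lu]; exact hP.inverses.ρ_ρi)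

theorem cρi_cρ (hP : P.IsRibbonObject) : (cρi P).comp (cρ P) = TwoCell.id _ :=
  TwoCell.ext' (by
    rw [comp_cell, id_cell, Path.ev_nil, pow_one]; exact hP.inverses.ρi_ρ)

theorem cl_cli (hP : P.IsRibbonObject) : (cl P).comp (cli P) = TwoCell.id _ :=
  TwoCell.ext' (by
    rw [comp_cell, id_cell, Path.ev_pair, Layer.mor_tr, mor_LM, mor_Lu]
    exact hP.inverses.lam_lami)

theorem cli_cl (hP : P.IsRibbonObject) : (cli P).comp (cl P) = TwoCell.id _ :=
  TwoCell.ext' (by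
    rw [comp_cell, id_cell, Path.ev_nil, pow_one]; exact hP.inverses.lami_lam)

theorem cθ_cθi (hP : P.IsRibbonObject) : (cθ P).comp (cθi P) = TwoCell.id _ :=
  TwoCell.ext' (by
    rw [comp_cell, id_cell, Path.ev_nil, pow_one]; exact hP.inverses.θ_θi)

theorem cθi_cθ (hP : P.IsRibbonObject) : (cθi P).comp (cθ P) = TwoCell.id _ :=
  TwoCell.ext' (by
    rw [comp_cell, id_cell, Path.ev_nil, pow_one]; exact hP.inverses.θi_θ)

theorem cφl_cφli (hP : P.IsRibbonObject) : (cφl P).comp (cφli P) = TwoCell.id _ :=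
  TwoCell.ext' (by
    rw [comp_cell, id_cell, cell_cφl, cell_cφli, mor_frobL]; exact hP.rigidity.phiL_phiLInv)

theorem cφli_cφl (hP : P.IsRibbonObject) : (cφli P).comp (cφl P) = TwoCell.id _ :=
  TwoCell.ext' (by
    rw [comp_cell, id_cell, cell_cφl, cell_cφli, Path.ev_pair, mor_LM, mor_LD]
    exact hP.rigidity.phiLInv_phiL)

theorem cφr_cφri (hP : P.IsRibbonObject) : (cφr P).comp (cφri P) = TwoCell.id _ :=
  TwoCell.ext' (by
    rw [comp_cell, id_cell, cell_cφr, cell_cφri, mor_frobR]; exact hP.rigidity.phiR_phiRInv)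

theorem cφri_cφr (hP : P.IsRibbonObject) : (cφri P).comp (cφr P) = TwoCell.id _ :=
  TwoCell.ext' (by
    rw [comp_cell, id_cell, cell_cφr, cell_cφri, Path.ev_pair, mor_LM, mor_LD]
    exact hP.rigidity.phiRInv_phiR)

theorem pants_eq (hP : P.IsRibbonObject) :
    ((cη P).wh (𝗠 ⊲ .nil) .nil).comp ((cε P).wh .nil (𝗠 ⊳ .nil)) = TwoCell.id (𝗠 ⊳ .nil) :=
  TwoCell.ext' (by
    simp only [comp_cell, wh_nil_left, wh_nil_right, id_cell, Ctx.ev_singleton, Path.ev_singleton,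
      mor_LM]
    exact hP.biadjoint.pants)

theorem copants_eq (hP : P.IsRibbonObject) :
    ((cη P).wh .nil (𝗗 ⊳ .nil)).comp ((cε P).wh (𝗗 ⊲ .nil) .nil) = TwoCell.id (𝗗 ⊳ .nil) :=
  TwoCell.ext' (by
    simp only [comp_cell, wh_nil_left, wh_nil_right, id_cell, Ctx.ev_singleton, Path.ev_singleton,
      mor_LD]
    exact hP.biadjoint.copants)

theorem pants_dagger_eq (hP : P.IsRibbonObject) :
    ((cεd P).wh .nil (𝗠 ⊳ .nil)).comp ((cηd P).wh (𝗠 ⊲ .nil) .nil) = TwoCell.id (𝗠 ⊳ .nil) :=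
  TwoCell.ext' (by
    simp only [comp_cell, wh_nil_left, wh_nil_right, id_cell, Ctx.ev_singleton, Path.ev_singleton,
      mor_LM]
    exact hP.biadjoint.pants_dagger)

theorem copants_dagger_eq (hP : P.IsRibbonObject) :
    ((cεd P).wh (𝗗 ⊲ .nil) .nil).comp ((cηd P).wh .nil (𝗗 ⊳ .nil)) = TwoCell.id (𝗗 ⊳ .nil) :=
  TwoCell.ext' (by
    simp only [comp_cell, wh_nil_left, wh_nil_right, id_cell, Ctx.ev_singleton, Path.ev_singleton,
      mor_LD]
    exact hP.biadjoint.copants_dagger)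

theorem cup_eq (hP : P.IsRibbonObject) :
    ((cν P).wh (𝘂 ⊲ .nil) .nil).comp ((cμ P).wh .nil (𝘂 ⊳ .nil)) = TwoCell.id (𝘂 ⊳ .nil) :=
  TwoCell.ext' (by
    simp only [comp_cell, wh_nil_left, wh_nil_right, id_cell, Ctx.ev_singleton, Path.ev_singleton,
      mor_Lu]
    exact hP.biadjoint.cup)

variable {b d : ℕ}

theorem pants_zigzag (hP : P.IsRibbonObject) (L : Ctx P 1 d) (R : Path P b 2) :
    slice (𝗠 ⊲ L) (cη P) R * slice L (cε P) (𝗠 ⊳ R) = idd (L.plug (𝗠 ⊳ R)) := by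
  simpa only [slice_comp, slice_wh, slice_id] using slice_congr (pants_eq hP) L R

theorem pants_zigzag_tl (hP : P.IsRibbonObject) (L : Ctx P 2 d) (R : Path P b 3) :
    slice ((𝗠).tl ⊲ L) (cη P).tl R * slice L (cε P).tl ((𝗠).tl ⊳ R) =
      idd (L.plug ((𝗠).tl ⊳ R)) := by
  simpa only [slice_comp, tl_comp, tl_id, slice_tl_wh, slice_id] using
    slice_tl_congr (pants_eq hP) L R

theorem copants_zigzag (hP : P.IsRibbonObject) (L : Ctx P 2 d) (R : Path P b 1) :
    slice L (cη P) (𝗗 ⊳ R) * slice (𝗗 ⊲ L) (cε P) R = idd (L.plug (𝗗 ⊳ R)) := by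
  simpa only [slice_comp, slice_wh, slice_id] using slice_congr (copants_eq hP) L R

theorem copants_zigzag_tr (hP : P.IsRibbonObject) (L : Ctx P 3 d) (R : Path P b 2) :
    slice L (cη P).tr ((𝗗).tr ⊳ R) * slice ((𝗗).tr ⊲ L) (cε P).tr R =
      idd (L.plug ((𝗗).tr ⊳ R)) := by
  simpa only [slice_comp, tr_comp, tr_id, slice_tr_wh, slice_id] using
    slice_tr_congr (copants_eq hP) L R

theorem pants_dagger_zigzag (hP : P.IsRibbonObject) (L : Ctx P 1 d) (R : Path P b 2) :
    slice L (cεd P) (𝗠 ⊳ R) * slice (𝗠 ⊲ L) (cηd P) R = idd (L.plug (𝗠 ⊳ R)) := by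
  simpa only [slice_comp, slice_wh, slice_id] using slice_congr (pants_dagger_eq hP) L R

theorem copants_dagger_zigzag (hP : P.IsRibbonObject) (L : Ctx P 2 d) (R : Path P b 1) :
    slice (𝗗 ⊲ L) (cεd P) R * slice L (cηd P) (𝗗 ⊳ R) = idd (L.plug (𝗗 ⊳ R)) := by
  simpa only [slice_comp, slice_wh, slice_id] using slice_congr (copants_dagger_eq hP) L R

theorem cup_zigzag (hP : P.IsRibbonObject) (L : Ctx P 1 d) (R : Path P b 0) :
    slice (𝘂 ⊲ L) (cν P) R * slice L (cμ P) (𝘂 ⊳ R) = idd (L.plug (𝘂 ⊳ R)) := by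
  simpa only [slice_comp, slice_wh, slice_id] using slice_congr (cup_eq hP) L R

theorem slice_cφl (L : Ctx P 2 d) (R : Path P b 2) :
    slice L (cφl P) R = slice L (cη P) ((𝗠).tr ⊳ (𝗗).tl ⊳ R) *
      (slice (𝗗 ⊲ L) (cα P) ((𝗗).tl ⊳ R) * slice (𝗠 ⊲ 𝗗 ⊲ L) (cε P).tl R) := by
  simp only [cφl, slice_comp, slice_wh]

theorem slice_cφli (L : Ctx P 2 d) (R : Path P b 2) :
    slice L (cφli P) R = slice (𝗠 ⊲ 𝗗 ⊲ L) (cεd P).tl R *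
      (slice (𝗗 ⊲ L) (cαi P) ((𝗗).tl ⊳ R) * slice L (cηd P) ((𝗠).tr ⊳ (𝗗).tl ⊳ R)) := by
  simp only [cφli, slice_comp, slice_wh]

theorem slice_cφr (L : Ctx P 2 d) (R : Path P b 2) :
    slice L (cφr P) R = slice L (cη P) ((𝗠).tl ⊳ (𝗗).tr ⊳ R) *
      (slice (𝗗 ⊲ L) (cαi P) ((𝗗).tr ⊳ R) * slice (𝗠 ⊲ 𝗗 ⊲ L) (cε P).tr R) := by
  simp only [cφr, slice_comp, slice_wh]

theorem slice_cφri (L : Ctx P 2 d) (R : Path P b 2) :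
    slice L (cφri P) R = slice (𝗠 ⊲ 𝗗 ⊲ L) (cεd P).tr R *
      (slice (𝗗 ⊲ L) (cα P) ((𝗗).tr ⊳ R) * slice L (cηd P) ((𝗠).tl ⊳ (𝗗).tr ⊳ R)) := by
  simp only [cφri, slice_comp, slice_wh]

/-- The interchanger of two pairs of pants. -/
def cx (P : RibbonData C) :
    TwoCell (P := P) ((𝗠).tr ⊳ (𝗠).tl.tl ⊳ .nil) ((𝗠).tl ⊳ (𝗠).tr.tr ⊳ .nil) :=
  ⟨C.xch P.M P.M,
    by rw [C.src_xch, Path.ev_pair, Layer.mor_tl, Layer.mor_tr, Layer.mor_tl, mor_LM, C.tl_tl,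
      P.dom_M, P.cod_M],
    by rw [C.tgt_xch, Path.ev_pair, Layer.mor_tl, Layer.mor_tr, Layer.mor_tr, mor_LM, C.tr_tr,
      P.dom_M, P.cod_M]⟩

/-- The inverse of the interchanger of two pairs of pants. -/
def cxi (P : RibbonData C) :
    TwoCell (P := P) ((𝗠).tl ⊳ (𝗠).tr.tr ⊳ .nil) ((𝗠).tr ⊳ (𝗠).tl.tl ⊳ .nil) :=
  ⟨C.xchInv P.M P.M,
    by rw [C.src_xchInv, Path.ev_pair, Layer.mor_tl, Layer.mor_tr, Layer.mor_tr, mor_LM, C.tr_tr,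
      P.dom_M, P.cod_M],
    by rw [C.tgt_xchInv, Path.ev_pair, Layer.mor_tl, Layer.mor_tr, Layer.mor_tl, mor_LM, C.tl_tl,
      P.dom_M, P.cod_M]⟩

/-- The interchanger of the copants and the cap. -/
def cy (P : RibbonData C) :
    TwoCell (P := P) (𝗗 ⊳ (𝗲).tl ⊳ .nil) ((𝗲).tl.tl ⊳ (𝗗).tr ⊳ .nil) :=
  ⟨C.xch P.D P.e,
    by rw [C.src_xch, Path.ev_pair, Layer.mor_tl, mor_LD, mor_Le, P.dom_D, P.cod_e, C.tr_unit],
    by rw [C.tgt_xch, Path.ev_pair, Layer.mor_tl, Layer.mor_tl, Layer.mor_tr, mor_LD, mor_Le,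
      C.tl_tl, P.cod_D, P.dom_e]⟩

/-- The inverse of the interchanger of the copants and the cap. -/
def cyi (P : RibbonData C) :
    TwoCell (P := P) ((𝗲).tl.tl ⊳ (𝗗).tr ⊳ .nil) (𝗗 ⊳ (𝗲).tl ⊳ .nil) :=
  ⟨C.xchInv P.D P.e,
    by rw [C.src_xchInv, Path.ev_pair, Layer.mor_tl, Layer.mor_tl, Layer.mor_tr, mor_LD, mor_Le,
      C.tl_tl, P.cod_D, P.dom_e],
    by rw [C.tgt_xchInv, Path.ev_pair, Layer.mor_tl, mor_LD, mor_Le, P.dom_D, P.cod_e, C.tr_unit]⟩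

theorem cx_cxi : (cx P).comp (cxi P) = TwoCell.id _ :=
  TwoCell.ext' (by
    rw [comp_cell, id_cell, ← (cx P).src_cell]
    exact (C.xch_xchInv _ _).trans (by rw [← C.src_xch]; rfl))

theorem cxi_cx : (cxi P).comp (cx P) = TwoCell.id _ :=
  TwoCell.ext' (by
    rw [comp_cell, id_cell, ← (cxi P).src_cell]
    exact (C.xchInv_xch _ _).trans (by rw [← C.src_xchInv]; rfl))

theorem cy_cyi : (cy P).comp (cyi P) = TwoCell.id _ :=
  TwoCell.ext' (by
    rw [comp_cell, id_cell, ← (cy P).src_cell]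
    exact (C.xch_xchInv _ _).trans (by rw [← C.src_xch]; rfl))

theorem pentagon_eq (hP : P.IsRibbonObject) :
    ((cα P).wh .nil ((𝗠).tr.tr ⊳ .nil)).comp
      (((cxi P).wh (𝗠 ⊲ .nil) .nil).comp ((cα P).wh .nil ((𝗠).tl.tl ⊳ .nil))) =
      ((cα P).tr.wh (𝗠 ⊲ .nil) .nil).comp
        (((cα P).wh .nil ((𝗠).tr.tl ⊳ .nil)).comp ((cα P).tl.wh (𝗠 ⊲ .nil) .nil)) :=
  TwoCell.ext' (by
    simp only [comp_cell, wh_nil_left, wh_nil_right, Ctx.ev_singleton, Path.ev_singleton,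
      Layer.mor_tl, mor_LM, Layer.mor_tr, tl_cell, tr_cell]
    exact hP.monoidal.pentagon)

theorem triangle_eq (hP : P.IsRibbonObject) :
    (cρ P).tr.wh (𝗠 ⊲ .nil) .nil =
      ((cα P).wh .nil ((𝘂).tr.tl ⊳ .nil)).comp ((cl P).tl.wh (𝗠 ⊲ .nil) .nil) :=
  TwoCell.ext' (by
    simp only [comp_cell, wh_nil_left, wh_nil_right, Ctx.ev_singleton, Path.ev_singleton,
      Layer.mor_tl, mor_LM, mor_Lu, Layer.mor_tr, tl_cell, tr_cell]
    exact hP.monoidal.triangle)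

/-- The composite around a hole carrying `z` on the left leg and `w` on the right leg. -/
def loop (z w : TwoCell (P := P) (n := 1) .nil .nil) : TwoCell (P := P) (n := 1) .nil .nil :=
  (cεd P).comp ((z.tr.wh (𝗠 ⊲ .nil) (𝗗 ⊳ .nil)).comp
    ((w.tl.wh (𝗠 ⊲ .nil) (𝗗 ⊳ .nil)).comp (cε P)))

theorem pentagon (hP : P.IsRibbonObject) (L : Ctx P 1 d) (R : Path P b 4) :
    slice L (cα P) ((𝗠).tr.tr ⊳ R) *
        (slice (𝗠 ⊲ L) (cxi P) R * slice L (cα P) ((𝗠).tl.tl ⊳ R)) =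
      slice (𝗠 ⊲ L) (cα P).tr R *
        (slice L (cα P) ((𝗠).tr.tl ⊳ R) * slice (𝗠 ⊲ L) (cα P).tl R) := by
  simpa only [slice_comp, slice_wh] using slice_congr (pentagon_eq hP) L R

theorem triangle (hP : P.IsRibbonObject) (L : Ctx P 1 d) (R : Path P b 2) :
    slice (𝗠 ⊲ L) (cρ P).tr R =
      slice L (cα P) ((𝘂).tr.tl ⊳ R) * slice (𝗠 ⊲ L) (cl P).tl R := by
  simpa only [slice_comp, slice_wh] using slice_congr (triangle_eq hP) L R

theorem ribbon_eq (hP : P.IsRibbonObject) :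
    (cθ P).tr.wh .nil (𝗗 ⊳ 𝘂 ⊳ .nil) = (cθ P).tl.wh .nil (𝗗 ⊳ 𝘂 ⊳ .nil) :=
  TwoCell.ext' (by
    simp only [wh_nil_left, Path.ev_pair, mor_LD, mor_Lu, tl_cell, tr_cell]
    exact hP.ribbon)

theorem pivotal_right_eq (hP : P.IsRibbonObject) :
    ((cεd P).wh (𝗲 ⊲ .nil) (𝘂 ⊳ .nil)).comp
      (((cμd P).tl.wh (𝗠 ⊲ 𝗲 ⊲ .nil) (𝗗 ⊳ 𝘂 ⊳ .nil)).comp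
        (((cμ P).tl.wh (𝗠 ⊲ 𝗲 ⊲ .nil) (𝗗 ⊳ 𝘂 ⊳ .nil)).comp
          ((cε P).wh (𝗲 ⊲ .nil) (𝘂 ⊳ .nil)))) = TwoCell.id (𝗲 ⊳ 𝘂 ⊳ .nil) :=
  TwoCell.ext' (by
    simp only [comp_cell, id_cell, wh_cons, Path.ev_pair, Path.ev_singleton, Ctx.ev_pair,
      Ctx.ev_singleton, mor_LD, mor_Lu, mor_LM, mor_Le, tl_cell]
    exact hP.pivotality.right)

theorem pivotal_left_eq (hP : P.IsRibbonObject) :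
    ((cεd P).wh (𝗲 ⊲ .nil) (𝘂 ⊳ .nil)).comp
      (((cμd P).tr.wh (𝗠 ⊲ 𝗲 ⊲ .nil) (𝗗 ⊳ 𝘂 ⊳ .nil)).comp
        (((cμ P).tr.wh (𝗠 ⊲ 𝗲 ⊲ .nil) (𝗗 ⊳ 𝘂 ⊳ .nil)).comp
          ((cε P).wh (𝗲 ⊲ .nil) (𝘂 ⊳ .nil)))) = TwoCell.id (𝗲 ⊳ 𝘂 ⊳ .nil) :=
  TwoCell.ext' (by
    simp only [comp_cell, id_cell, wh_cons, Path.ev_pair, Path.ev_singleton, Ctx.ev_pair,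
      Ctx.ev_singleton, mor_LD, mor_Lu, mor_LM, mor_Le, tr_cell]
    exact hP.pivotality.left)

theorem pivotal_right (hP : P.IsRibbonObject) (L : Ctx P 0 d) (R : Path P b 0) :
    slice (𝗲 ⊲ L) (cεd P) (𝘂 ⊳ R) *
      (slice (𝗠 ⊲ 𝗲 ⊲ L) (cμd P).tl (𝗗 ⊳ 𝘂 ⊳ R) *
        (slice (𝗠 ⊲ 𝗲 ⊲ L) (cμ P).tl (𝗗 ⊳ 𝘂 ⊳ R) * slice (𝗲 ⊲ L) (cε P) (𝘂 ⊳ R))) =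
      idd (L.plug (𝗲 ⊳ 𝘂 ⊳ R)) := by
  simpa only [slice_comp, slice_wh, slice_id] using slice_congr (pivotal_right_eq hP) L R

theorem pivotal_left (hP : P.IsRibbonObject) (L : Ctx P 0 d) (R : Path P b 0) :
    slice (𝗲 ⊲ L) (cεd P) (𝘂 ⊳ R) *
      (slice (𝗠 ⊲ 𝗲 ⊲ L) (cμd P).tr (𝗗 ⊳ 𝘂 ⊳ R) *
        (slice (𝗠 ⊲ 𝗲 ⊲ L) (cμ P).tr (𝗗 ⊳ 𝘂 ⊳ R) * slice (𝗲 ⊲ L) (cε P) (𝘂 ⊳ R))) =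
      idd (L.plug (𝗲 ⊳ 𝘂 ⊳ R)) := by
  simpa only [slice_comp, slice_wh, slice_id] using slice_congr (pivotal_left_eq hP) L R

section Slide
variable (z : TwoCell (P := P) (n := 1) .nil .nil)

theorem src_endo : C.src z.cell = C.one P.X := by rw [z.src_cell, Path.ev_nil, pow_one]
theorem tgt_endo : C.tgt z.cell = C.one P.X := by rw [z.tgt_cell, Path.ev_nil, pow_one]

/-- An endomorphism of `id_X` on the left slides past any 1-morphism on the right of it: the
interchanger with an identity is an identity. -/
theorem slide_left (g : C.Mor) :
    C.hcomp (C.tr₂ z.cell (C.cod g)) (C.idc (C.tl P.X g)) =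
      C.hcomp (C.idc (C.tl P.X g)) (C.tr₂ z.cell (C.dom g)) := by
  have h := C.xch_nat_left z.cell g
  have h1 : C.dom (C.src (C.tr₂ z.cell (C.cod g))) = C.cod (C.src (C.idc (C.tl P.X g))) := by
    rw [C.src_tr₂, C.dom_tr, src_endo, C.dom_one, C.src_idc, C.cod_tl]
  have h2 : C.dom (C.src (C.idc (C.tl P.X g))) = C.cod (C.src (C.tr₂ z.cell (C.dom g))) := by
    rw [C.src_tr₂, C.cod_tr, src_endo, C.cod_one, C.src_idc, C.dom_tl]
  rw [tgt_endo, src_endo, C.dom_one, C.cod_one, C.xch_one_left,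
    C.vcomp_idc_of_tgt, C.idc_vcomp_of_src] at h
  · exact h
  · rw [C.src_hcomp _ _ h2, C.src_idc, C.src_tr₂, src_endo, C.tr_one, C.comp_one_of_dom]
    rw [C.dom_tl]
  · rw [C.tgt_hcomp _ _ h1, C.tgt_idc, C.tgt_tr₂, tgt_endo, C.tr_one, C.one_comp_of_cod]
    rw [C.cod_tl]

/-- An endomorphism of `id_X` on the right slides past any 1-morphism on the left of it. -/
theorem slide_right (f : C.Mor) :
    C.hcomp (C.idc (C.tr f P.X)) (C.tl₂ (C.dom f) z.cell) =
      C.hcomp (C.tl₂ (C.cod f) z.cell) (C.idc (C.tr f P.X)) := by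
  have h := C.xch_nat_right f z.cell
  have h1 : C.dom (C.src (C.tl₂ (C.cod f) z.cell)) = C.cod (C.src (C.idc (C.tr f P.X))) := by
    rw [C.src_tl₂, C.dom_tl, src_endo, C.dom_one, C.src_idc, C.cod_tr]
  have h2 : C.dom (C.src (C.idc (C.tr f P.X))) = C.cod (C.src (C.tl₂ (C.dom f) z.cell)) := by
    rw [C.src_tl₂, C.cod_tl, src_endo, C.cod_one, C.src_idc, C.dom_tr]
  rw [tgt_endo, src_endo, C.dom_one, C.cod_one, C.xch_one_right,
    C.vcomp_idc_of_tgt, C.idc_vcomp_of_src] at h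
  · exact h
  · rw [C.src_hcomp _ _ h1, C.src_idc, C.src_tl₂, src_endo, C.tl_one, C.one_comp_of_cod]
    rw [C.cod_tr]
  · rw [C.tgt_hcomp _ _ h2, C.tgt_idc, C.tgt_tl₂, tgt_endo, C.tl_one, C.comp_one_of_dom]
    rw [C.dom_tr]

theorem slide_left_M_eq :
    z.tr.wh .nil ((𝗠).tl ⊳ .nil) = z.tr.tr.wh ((𝗠).tl ⊲ .nil) .nil :=
  TwoCell.ext' (by
    have h := slide_left z P.M
    rw [P.dom_M, P.cod_M, ← C.tr₂_tr₂] at h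
    simpa only [wh_nil_left, wh_nil_right, Ctx.ev_singleton, Path.ev_singleton, Layer.mor_tl,
      mor_LM, tr_cell] using h)

theorem slide_right_M_eq :
    z.tl.wh .nil ((𝗠).tr ⊳ .nil) = z.tl.tl.wh ((𝗠).tr ⊲ .nil) .nil :=
  TwoCell.ext' (by
    have h := (slide_right z P.M).symm
    rw [P.dom_M, P.cod_M, ← C.tl₂_tl₂] at h
    simpa only [wh_nil_left, wh_nil_right, Ctx.ev_singleton, Path.ev_singleton, Layer.mor_tr,
      mor_LM, tl_cell] using h)

theorem slide_left_e_eq :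
    z.wh .nil ((𝗲).tl ⊳ .nil) = z.tr.wh ((𝗲).tl ⊲ .nil) .nil :=
  TwoCell.ext' (by
    have h := slide_left z P.e
    rw [P.dom_e, P.cod_e, C.tr₂_unit] at h
    simpa only [wh_nil_left, wh_nil_right, Ctx.ev_singleton, Path.ev_singleton, Layer.mor_tl,
      mor_Le, tr_cell] using h)

theorem slide_right_e_eq :
    z.wh .nil ((𝗲).tr ⊳ .nil) = z.tl.wh ((𝗲).tr ⊲ .nil) .nil :=
  TwoCell.ext' (by
    have h := (slide_right z P.e).symm
    rw [P.dom_e, P.cod_e, C.unit_tl₂] at h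
    simpa only [wh_nil_left, wh_nil_right, Ctx.ev_singleton, Path.ev_singleton, Layer.mor_tr,
      mor_Le, tl_cell] using h)

theorem slide_left_M (L : Ctx P 2 d) (R : Path P b 3) :
    slice L z.tr ((𝗠).tl ⊳ R) = slice ((𝗠).tl ⊲ L) z.tr.tr R := by
  simpa only [slice_wh] using slice_congr (slide_left_M_eq z) L R

theorem slide_left_M_tl (L : Ctx P 3 d) (R : Path P b 4) :
    slice L z.tr.tl ((𝗠).tl.tl ⊳ R) = slice ((𝗠).tl.tl ⊲ L) z.tr.tr.tl R := by
  simpa only [slice_tl_wh] using slice_tl_congr (slide_left_M_eq z) L R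

theorem slide_right_M (L : Ctx P 2 d) (R : Path P b 3) :
    slice L z.tl ((𝗠).tr ⊳ R) = slice ((𝗠).tr ⊲ L) z.tl.tl R := by
  simpa only [slice_wh] using slice_congr (slide_right_M_eq z) L R

theorem slide_right_M_tr (L : Ctx P 3 d) (R : Path P b 4) :
    slice L z.tl.tr ((𝗠).tr.tr ⊳ R) = slice ((𝗠).tr.tr ⊲ L) z.tl.tl.tr R := by
  simpa only [slice_tr_wh] using slice_tr_congr (slide_right_M_eq z) L R

theorem slide_left_e_tl (L : Ctx P 2 d) (R : Path P b 3) :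
    slice L z.tl ((𝗲).tl.tl ⊳ R) = slice ((𝗲).tl.tl ⊲ L) z.tr.tl R := by
  simpa only [slice_tl_wh] using slice_tl_congr (slide_left_e_eq z) L R

theorem slide_right_e (L : Ctx P 1 d) (R : Path P b 2) :
    slice L z ((𝗲).tr ⊳ R) = slice ((𝗲).tr ⊲ L) z.tl R := by
  simpa only [slice_wh] using slice_congr (slide_right_e_eq z) L R

end Slide

end Axioms

variable {b d : ℕ}

/-! ### The Frobeniusators -/

theorem cφl_cε (hP : P.IsRibbonObject) (L : Ctx P 1 d) (R : Path P b 2) :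
    slice (𝗠 ⊲ L) (cφl P) R * slice L (cε P) (𝗠 ⊳ R) =
      slice L (cα P) ((𝗗).tl ⊳ R) * slice (𝗠 ⊲ L) (cε P).tl R := by
  rw [slice_cφl, mul_assoc, mul_assoc, ← exch (cε P) (cε P).tl (𝗠 ⊳ .nil) rfl rfl,
    ← exch_assoc (cε P) (cα P) .nil rfl rfl, mul_mul_of_eq (pants_zigzag hP _ _)]
  simp only [idd_mul_slice_mul]

theorem cφr_cε (hP : P.IsRibbonObject) (L : Ctx P 1 d) (R : Path P b 2) :
    slice (𝗠 ⊲ L) (cφr P) R * slice L (cε P) (𝗠 ⊳ R) =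
      slice L (cαi P) ((𝗗).tr ⊳ R) * slice (𝗠 ⊲ L) (cε P).tr R := by
  rw [slice_cφr, mul_assoc, mul_assoc, ← exch (cε P) (cε P).tr (𝗠 ⊳ .nil) rfl rfl,
    ← exch_assoc (cε P) (cαi P) .nil rfl rfl, mul_mul_of_eq (pants_zigzag hP _ _)]
  simp only [idd_mul_slice_mul]

theorem cεd_cφli (hP : P.IsRibbonObject) (L : Ctx P 1 d) (R : Path P b 2) :
    slice L (cεd P) (𝗠 ⊳ R) * slice (𝗠 ⊲ L) (cφli P) R =
      slice (𝗠 ⊲ L) (cεd P).tl R * slice L (cαi P) ((𝗗).tl ⊳ R) := by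
  rw [slice_cφli, exch_assoc (cεd P) (cεd P).tl (𝗠 ⊳ .nil) rfl rfl,
    exch_assoc (cεd P) (cαi P) .nil rfl rfl, pants_dagger_zigzag hP]
  simp only [slice_mul_idd]

theorem cεd_cφri (hP : P.IsRibbonObject) (L : Ctx P 1 d) (R : Path P b 2) :
    slice L (cεd P) (𝗠 ⊳ R) * slice (𝗠 ⊲ L) (cφri P) R =
      slice (𝗠 ⊲ L) (cεd P).tr R * slice L (cα P) ((𝗗).tr ⊳ R) := by
  rw [slice_cφri, exch_assoc (cεd P) (cεd P).tr (𝗠 ⊳ .nil) rfl rfl,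
    exch_assoc (cεd P) (cα P) .nil rfl rfl, pants_dagger_zigzag hP]
  simp only [slice_mul_idd]

/-- Opening a hole above a pair of pants is the same as opening it on the left leg and moving it
through the pants by the right Frobeniusator. -/
theorem cεd_cα_cφr (hP : P.IsRibbonObject) (L : Ctx P 1 d) (R : Path P b 2) :
    slice (𝗠 ⊲ L) (cεd P).tr R * (slice L (cα P) ((𝗗).tr ⊳ R) * slice (𝗠 ⊲ L) (cφr P) R) =
      slice L (cεd P) (𝗠 ⊳ R) := by
  rw [← mul_assoc, ← cεd_cφri hP, mul_assoc, slice_inv (cφri_cφr hP)]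
  simp only [slice_mul_idd]

theorem cφl_cε_tr (hP : P.IsRibbonObject) (L : Ctx P 2 d) (R : Path P b 3) :
    slice ((𝗠).tr ⊲ L) (cφl P).tr R * slice L (cε P).tr ((𝗠).tr ⊳ R) =
      slice L (cα P).tr ((𝗗).tr.tl ⊳ R) * slice ((𝗠).tr ⊲ L) (cε P).tr.tl R := by
  have h : ((cφl P).wh (𝗠 ⊲ .nil) .nil).comp ((cε P).wh .nil (𝗠 ⊳ .nil)) =
      ((cα P).wh .nil ((𝗗).tl ⊳ .nil)).comp ((cε P).tl.wh (𝗠 ⊲ .nil) .nil) :=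
    TwoCell.ext_slice (by simpa only [slice_comp, slice_wh] using cφl_cε hP .nil .nil)
  simpa only [tr_comp, slice_comp, slice_tr_wh, slice_tl_tr] using slice_tr_congr h L R

theorem cφr_cε_tl (hP : P.IsRibbonObject) (L : Ctx P 2 d) (R : Path P b 3) :
    slice ((𝗠).tl ⊲ L) (cφr P).tl R * slice L (cε P).tl ((𝗠).tl ⊳ R) =
      slice L (cαi P).tl ((𝗗).tr.tl ⊳ R) * slice ((𝗠).tl ⊲ L) (cε P).tr.tl R := by
  have h : ((cφr P).wh (𝗠 ⊲ .nil) .nil).comp ((cε P).wh .nil (𝗠 ⊳ .nil)) =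
      ((cαi P).wh .nil ((𝗗).tr ⊳ .nil)).comp ((cε P).tr.wh (𝗠 ⊲ .nil) .nil) :=
    TwoCell.ext_slice (by simpa only [slice_comp, slice_wh] using cφr_cε hP .nil .nil)
  simpa only [tl_comp, slice_comp, slice_tl_wh] using slice_tl_congr h L R

theorem pentagon_inv (hP : P.IsRibbonObject) (L : Ctx P 1 d) (R : Path P b 4) :
    slice (𝗠 ⊲ L) (cx P) R * (slice L (cαi P) ((𝗠).tr.tr ⊳ R) *
        (slice (𝗠 ⊲ L) (cα P).tr R * slice L (cα P) ((𝗠).tr.tl ⊳ R))) =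
      slice L (cα P) ((𝗠).tl.tl ⊳ R) * slice (𝗠 ⊲ L) (cαi P).tl R := by
  have h : slice (𝗠 ⊲ L) (cα P).tr R * slice L (cα P) ((𝗠).tr.tl ⊳ R) =
      slice L (cα P) ((𝗠).tr.tr ⊳ R) * (slice (𝗠 ⊲ L) (cxi P) R *
        (slice L (cα P) ((𝗠).tl.tl ⊳ R) * slice (𝗠 ⊲ L) (cαi P).tl R)) := by
    rw [mul_mul_mul_of_eq (pentagon hP L R), mul_assoc, mul_assoc,
      slice_inv_tl (cα_cαi hP) (𝗠 ⊲ L) R]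
    simp only [slice_mul_idd]
  rw [h, mul_mul_of_eq (slice_inv (cαi_cα hP) _ _)]
  simp only [idd_mul_slice_mul]
  rw [mul_mul_of_eq (slice_inv cx_cxi _ _)]
  simp only [idd_mul_slice_mul]

/-- A 2-morphism into `D ∘ q` is determined by its mate under `M ⊣ D`. -/
theorem ext_mate {n : ℕ} {s : Path P n 2} {q : Path P n 1} (hP : P.IsRibbonObject)
    {a a' : TwoCell s (𝗗 ⊳ q)}
    (h : slice (𝗠 ⊲ 𝗗 ⊲ .nil) a .nil * slice (𝗗 ⊲ .nil) (cε P) (q.append .nil) =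
      slice (𝗠 ⊲ 𝗗 ⊲ .nil) a' .nil * slice (𝗗 ⊲ .nil) (cε P) (q.append .nil)) : a = a' := by
  have key : ∀ a : TwoCell s (𝗗 ⊳ q), slice .nil a .nil = slice .nil (cη P) (s.append .nil) *
      (slice (𝗠 ⊲ 𝗗 ⊲ .nil) a .nil * slice (𝗗 ⊲ .nil) (cε P) (q.append .nil)) := fun a => by
    rw [exch_assoc (cη P) a .nil rfl rfl, copants_zigzag hP]
    simp only [slice_mul_idd]
  exact TwoCell.ext_slice (by rw [key a, key a', h])

theorem frobenius_bimodule_eq (hP : P.IsRibbonObject) :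
    ((cx P).wh .nil ((𝗗).tr.tl ⊳ .nil)).comp (((cφl P).tr.wh ((𝗠).tl ⊲ .nil) .nil).comp
      (((cφr P).wh .nil ((𝗠).tr ⊳ .nil)).comp ((cα P).wh (𝗗 ⊲ .nil) .nil))) =
    ((cφr P).tl.wh ((𝗠).tr ⊲ .nil) .nil).comp ((cφl P).wh .nil ((𝗠).tl ⊳ .nil)) := by
  apply ext_mate hP
  simp only [slice_comp, slice_wh, mul_assoc]
  rw [← exch (cε P) (cα P) .nil rfl rfl, mul_mul_of_eq (cφr_cε hP _ _), mul_assoc,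
    ← exch_assoc (cαi P) (cφl P).tr .nil rfl rfl, mul_mul_of_eq (cφl_cε_tr hP _ _), mul_assoc,
    ← exch (cα P) (cε P).tr.tl .nil rfl rfl, cφl_cε hP, 
    ← exch_assoc (cα P) (cφr P).tl .nil rfl rfl, cφr_cε_tl hP]
  rw [← mul_assoc _ _ (slice _ (cε P).tr.tl _), ← mul_assoc _ _ (slice _ (cε P).tr.tl _),
    ← mul_assoc _ _ (slice _ (cε P).tr.tl _), ← mul_assoc _ _ (slice _ (cε P).tr.tl _)]
  rw [pentagon_inv hP]

/-- The two Frobeniusators are compatible: `D` is a bimodule for the pseudomonoid `X`. -/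
theorem frobenius_bimodule (hP : P.IsRibbonObject) (L : Ctx P 2 d) (R : Path P b 3) :
    slice L (cx P) ((𝗗).tr.tl ⊳ R) * (slice ((𝗠).tl ⊲ L) (cφl P).tr R *
      (slice L (cφr P) ((𝗠).tr ⊳ R) * slice (𝗗 ⊲ L) (cα P) R)) =
    slice ((𝗠).tr ⊲ L) (cφr P).tl R * slice L (cφl P) ((𝗠).tl ⊳ R) := by
  simpa only [slice_comp, slice_wh] using slice_congr (frobenius_bimodule_eq hP) L R

/-! ### Conjugates of endomorphisms by the Frobeniusators -/

/-- The 2-morphisms of `id_X`. -/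
abbrev Endo (P : RibbonData C) := TwoCell (P := P) (n := 1) .nil .nil

/-- The conjugate by the left Frobeniusator of `z` on the middle cylinder. For `z = θ` it is the
missing Dehn twist `II`. -/
def twistL (z : Endo P) : TwoCell (P := P) (𝗗 ⊳ 𝗠 ⊳ .nil) (𝗗 ⊳ 𝗠 ⊳ .nil) :=
  (cφli P).comp ((z.tr.tl.wh ((𝗠).tr ⊲ .nil) ((𝗗).tl ⊳ .nil)).comp (cφl P))

/-- The conjugate by the right Frobeniusator of `z` on the middle cylinder. -/
def twistR (z : Endo P) : TwoCell (P := P) (𝗗 ⊳ 𝗠 ⊳ .nil) (𝗗 ⊳ 𝗠 ⊳ .nil) :=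
  (cφri P).comp ((z.tr.tl.wh ((𝗠).tl ⊲ .nil) ((𝗗).tr ⊳ .nil)).comp (cφr P))

theorem slice_twistL (z : Endo P) (L : Ctx P 2 d) (R : Path P b 2) :
    slice L (twistL z) R = slice L (cφli P) R *
      (slice ((𝗠).tr ⊲ L) z.tr.tl ((𝗗).tl ⊳ R) * slice L (cφl P) R) := by
  simp only [twistL, slice_comp, slice_wh]

theorem slice_twistR (z : Endo P) (L : Ctx P 2 d) (R : Path P b 2) :
    slice L (twistR z) R = slice L (cφri P) R *
      (slice ((𝗠).tl ⊲ L) z.tr.tl ((𝗗).tr ⊳ R) * slice L (cφr P) R) := by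
  simp only [twistR, slice_comp, slice_wh]

theorem cφl_twistL (hP : P.IsRibbonObject) (z : Endo P) (L : Ctx P 2 d) (R : Path P b 2) :
    slice L (cφl P) R * slice L (twistL z) R =
      slice ((𝗠).tr ⊲ L) z.tr.tl ((𝗗).tl ⊳ R) * slice L (cφl P) R := by
  rw [slice_twistL, mul_mul_of_eq (slice_inv (cφl_cφli hP) _ _)]
  simp only [idd_mul_slice_mul]

theorem cφr_twistR (hP : P.IsRibbonObject) (z : Endo P) (L : Ctx P 2 d) (R : Path P b 2) :
    slice L (cφr P) R * slice L (twistR z) R =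
      slice ((𝗠).tl ⊲ L) z.tr.tl ((𝗗).tr ⊳ R) * slice L (cφr P) R := by
  rw [slice_twistR, mul_mul_of_eq (slice_inv (cφr_cφri hP) _ _)]
  simp only [idd_mul_slice_mul]

/-- The endomorphisms `z` of `id_X` that agree on the two legs of the bent cylinder `D ∘ u`. -/
def IsRibbonEndo (z : Endo P) : Prop :=
  z.tr.wh .nil (𝗗 ⊳ 𝘂 ⊳ .nil) = z.tl.wh .nil (𝗗 ⊳ 𝘂 ⊳ .nil)

theorem IsRibbonEndo.slice_tr_tl {z : Endo P} (hz : IsRibbonEndo z) (L : Ctx P 4 d)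
    (R : Path P b 2) :
    slice L z.tr.tr.tl ((𝗗).tr.tl ⊳ (𝘂).tr.tl ⊳ R) =
      slice L z.tl.tr.tl ((𝗗).tr.tl ⊳ (𝘂).tr.tl ⊳ R) := by
  have h : z.tr.tr.wh .nil ((𝗗).tr ⊳ (𝘂).tr ⊳ .nil) = z.tl.tr.wh .nil ((𝗗).tr ⊳ (𝘂).tr ⊳ .nil) :=
    TwoCell.ext_slice (by simpa only [slice_wh, slice_tr_wh] using slice_tr_congr hz .nil .nil)
  simpa only [slice_tl_wh] using slice_tl_congr h L R

/-- The bimodule identity with a unit inserted between the two actions. -/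
theorem frobenius_unit (hP : P.IsRibbonObject) (L : Ctx P 2 d) (R : Path P b 2) :
    slice ((𝗠).tr ⊲ L) (cφr P).tl ((𝘂).tr.tl ⊳ R) *
        (slice ((𝗗).tl ⊲ (𝗠).tr ⊲ L) (cl P).tl R * slice L (cφl P) R) =
      slice L (cx P) ((𝗗).tr.tl ⊳ (𝘂).tr.tl ⊳ R) *
        (slice ((𝗠).tl ⊲ L) (cφl P).tr ((𝘂).tr.tl ⊳ R) *
          (slice ((𝗗).tr ⊲ (𝗠).tl ⊲ L) (cρ P).tr R * slice L (cφr P) R)) := by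
  have h := congrArg (· * slice (𝗠 ⊲ 𝗗 ⊲ L) (cl P).tl R)
    (frobenius_bimodule hP L ((𝘂).tr.tl ⊳ R))
  simp only [mul_assoc] at h
  rw [exch (cφl P) (cl P).tl .nil rfl rfl, ← triangle hP (𝗗 ⊲ L) R,
    exch (cφr P) (cρ P).tr .nil rfl rfl] at h
  exact h.symm

/-- Both sides are determined by their action after the invertible 2-morphism of `frobenius_unit`,
along which they become `z` on one or on the other leg of a bent cylinder. -/
theorem twistL_eq_twistR (hP : P.IsRibbonObject) {z : Endo P} (hz : IsRibbonEndo z) :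
    twistL z = twistR z := by
  apply TwoCell.ext_slice
  have hl : slice ((𝗠).tr ⊲ .nil) (cφr P).tl ((𝘂).tr.tl ⊳ .nil) *
      (slice ((𝗗).tl ⊲ (𝗠).tr ⊲ .nil) (cl P).tl .nil *
        (slice .nil (cφl P) .nil * slice .nil (twistL z) .nil)) =
      slice ((𝗠).tl.tl ⊲ (𝗠).tr ⊲ .nil) z.tr.tr.tl ((𝗗).tr.tl ⊳ (𝘂).tr.tl ⊳ .nil) *
        (slice ((𝗠).tr ⊲ .nil) (cφr P).tl ((𝘂).tr.tl ⊳ .nil) *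
          (slice ((𝗗).tl ⊲ (𝗠).tr ⊲ .nil) (cl P).tl .nil * slice .nil (cφl P) .nil)) := by
    rw [cφl_twistL hP, ← exch_assoc z.tr.tl (cl P).tl ((𝗗).tl ⊳ .nil) rfl rfl,
      ← exch_assoc z.tr.tl (cφr P).tl .nil rfl rfl, slide_left_M_tl]
  have hr : slice .nil (cx P) ((𝗗).tr.tl ⊳ (𝘂).tr.tl ⊳ .nil) *
      (slice ((𝗠).tl ⊲ .nil) (cφl P).tr ((𝘂).tr.tl ⊳ .nil) *
        (slice ((𝗗).tr ⊲ (𝗠).tl ⊲ .nil) (cρ P).tr .nil *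
          (slice .nil (cφr P) .nil * slice .nil (twistR z) .nil))) =
      slice ((𝗠).tl.tl ⊲ (𝗠).tr ⊲ .nil) z.tr.tr.tl ((𝗗).tr.tl ⊳ (𝘂).tr.tl ⊳ .nil) *
        (slice .nil (cx P) ((𝗗).tr.tl ⊳ (𝘂).tr.tl ⊳ .nil) *
          (slice ((𝗠).tl ⊲ .nil) (cφl P).tr ((𝘂).tr.tl ⊳ .nil) *
            (slice ((𝗗).tr ⊲ (𝗠).tl ⊲ .nil) (cρ P).tr .nil * slice .nil (cφr P) .nil))) := by
    rw [cφr_twistR hP, ← slice_tl_tr, ← exch_assoc z.tl.tr (cρ P).tr ((𝗗).tr ⊳ .nil) rfl rfl,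
      ← exch_assoc z.tl.tr (cφl P).tr .nil rfl rfl]
    dsimp only [Path.append]
    rw [slide_right_M_tr, exch_assoc (cx P) z.tl.tl.tr .nil rfl rfl, slice_tl_tr]
    dsimp only [Ctx.push, Path.append]
    rw [hz.slice_tr_tl]
  have hx := congrArg (· * slice .nil (twistR z) .nil)
    (frobenius_unit hP (.nil : Ctx P 2 2) .nil)
  simp only [mul_assoc] at hx
  -- The 2-morphism of `frobenius_unit` has an explicit inverse.
  have cancel : ∀ Y : TwoCell (P := P) (𝗗 ⊳ 𝗠 ⊳ .nil) (𝗗 ⊳ 𝗠 ⊳ .nil),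
      slice .nil (cφli P) .nil * (slice ((𝗗).tl ⊲ (𝗠).tr ⊲ .nil) (cli P).tl .nil *
        (slice ((𝗠).tr ⊲ .nil) (cφri P).tl ((𝘂).tr.tl ⊳ .nil) *
          (slice ((𝗠).tr ⊲ .nil) (cφr P).tl ((𝘂).tr.tl ⊳ .nil) *
            (slice ((𝗗).tl ⊲ (𝗠).tr ⊲ .nil) (cl P).tl .nil *
              (slice .nil (cφl P) .nil * slice .nil Y .nil))))) = slice .nil Y .nil := fun Y => by
    rw [mul_mul_of_eq (slice_inv_tl (cφri_cφr hP) _ _)]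
    simp only [idd_mul_slice_mul]
    rw [mul_mul_of_eq (slice_inv_tl (cli_cl hP) _ _)]
    simp only [idd_mul_slice_mul]
    rw [mul_mul_of_eq (slice_inv (cφli_cφl hP) _ _)]
    simp only [idd_mul_slice]
  rw [← cancel (twistL z), ← cancel (twistR z), hx, hr, hl, frobenius_unit hP]

/-- The coassociator of the copants, the mate of the right Frobeniusator. -/
def ca (P : RibbonData C) :
    TwoCell (P := P) ((𝗗).tr ⊳ 𝗗 ⊳ .nil) ((𝗗).tl ⊳ 𝗗 ⊳ .nil) :=
  ((cη P).tl.wh .nil ((𝗗).tr ⊳ 𝗗 ⊳ .nil)).comp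
    (((cφr P).wh ((𝗗).tl ⊲ .nil) (𝗗 ⊳ .nil)).comp ((cε P).wh (𝗗 ⊲ (𝗗).tl ⊲ .nil) .nil))

theorem slice_ca (L : Ctx P 3 d) (R : Path P b 1) :
    slice L (ca P) R = slice L (cη P).tl ((𝗗).tr ⊳ 𝗗 ⊳ R) *
      (slice ((𝗗).tl ⊲ L) (cφr P) (𝗗 ⊳ R) * slice (𝗗 ⊲ (𝗗).tl ⊲ L) (cε P) R) := by
  simp only [ca, slice_comp, slice_wh]

theorem ca_cε (hP : P.IsRibbonObject) (L : Ctx P 2 d) (R : Path P b 1) :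
    slice ((𝗠).tl ⊲ L) (ca P) R * slice L (cε P).tl (𝗗 ⊳ R) =
      slice L (cφr P) (𝗗 ⊳ R) * slice (𝗗 ⊲ L) (cε P) R := by
  rw [slice_ca, mul_assoc, mul_assoc, ← exch (cε P).tl (cε P) (𝗗 ⊳ .nil) rfl rfl,
    ← exch_assoc (cε P).tl (cφr P) .nil rfl rfl, mul_mul_of_eq (pants_zigzag_tl hP _ _)]
  simp only [idd_mul_slice_mul]

theorem cη_cφl (hP : P.IsRibbonObject) (L : Ctx P 2 d) (R : Path P b 3) :
    slice ((𝗠).tr ⊲ L) (cη P).tl R * slice L (cφl P) ((𝗠).tl ⊳ R) =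
      slice L (cη P) ((𝗠).tr ⊳ R) * slice (𝗗 ⊲ L) (cα P) R := by
  rw [slice_cφl, ← exch_assoc (cη P) (cη P).tl ((𝗠).tr ⊳ .nil) rfl rfl,
    ← exch_assoc (cα P) (cη P).tl .nil rfl rfl, pants_zigzag_tl hP]
  simp only [slice_mul_idd]

theorem ca_cφl (hP : P.IsRibbonObject) (L : Ctx P 2 d) (R : Path P b 1) :
    slice ((𝗠).tr ⊲ L) (ca P) R * slice L (cφl P) (𝗗 ⊳ R) =
      slice L (cη P) ((𝗠).tr ⊳ (𝗗).tr ⊳ 𝗗 ⊳ R) * (slice (𝗗 ⊲ L) (cα P) ((𝗗).tr ⊳ 𝗗 ⊳ R) *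
        (slice (𝗠 ⊲ 𝗗 ⊲ L) (cφr P) (𝗗 ⊳ R) * slice (𝗗 ⊲ 𝗠 ⊲ 𝗗 ⊲ L) (cε P) R)) := by
  rw [slice_ca, mul_assoc, mul_assoc, ← exch (cφl P) (cε P) (𝗗 ⊳ .nil) rfl rfl,
    ← exch_assoc (cφl P) (cφr P) .nil rfl rfl, mul_mul_of_eq (cη_cφl hP _ _), mul_assoc]

theorem cεd_ca_cφl (hP : P.IsRibbonObject) (L : Ctx P 2 d) (R : Path P b 1) :
    slice L (cεd P).tr (𝗗 ⊳ R) * (slice ((𝗠).tr ⊲ L) (ca P) R * slice L (cφl P) (𝗗 ⊳ R)) =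
      slice (𝗗 ⊲ L) (cεd P) R := by
  rw [ca_cφl hP, ← exch_assoc (cη P) (cεd P).tr .nil rfl rfl,
    mul_mul_mul_of_eq (cεd_cα_cφr hP _ _), exch (cεd P) (cε P) .nil rfl rfl,
    mul_mul_of_eq (copants_zigzag hP _ _)]
  simp only [idd_mul_slice]

theorem cεd_cφli_copants (hP : P.IsRibbonObject) (L : Ctx P 2 d) (R : Path P b 1) :
    slice (𝗗 ⊲ L) (cεd P) R * slice L (cφli P) (𝗗 ⊳ R) =
      slice L (cεd P).tr (𝗗 ⊳ R) * slice ((𝗠).tr ⊲ L) (ca P) R := by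
  rw [← cεd_ca_cφl hP, mul_assoc, mul_assoc, slice_inv (cφl_cφli hP)]
  simp only [slice_mul_idd]

/-- Closing a hole on the left leg undoes the coassociator and the left Frobeniusator. -/
theorem ca_cφl_cε (hP : P.IsRibbonObject) (L : Ctx P 2 d) (R : Path P b 1) :
    slice ((𝗠).tr ⊲ L) (ca P) R * (slice L (cφl P) (𝗗 ⊳ R) * slice (𝗗 ⊲ L) (cε P) R) =
      slice L (cε P).tr (𝗗 ⊳ R) := by
  rw [← mul_assoc, ca_cφl hP, mul_assoc, mul_assoc, mul_assoc,
    ← exch (cε P) (cε P) .nil rfl rfl, mul_mul_of_eq (cφr_cε hP _ _), mul_assoc,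
    mul_mul_of_eq (slice_inv (cα_cαi hP) _ _)]
  simp only [idd_mul_slice_mul]
  rw [exch_assoc (cη P) (cε P).tr .nil rfl rfl, copants_zigzag hP]
  simp only [slice_mul_idd]

/-- Open a hole at the top, apply `Y` in the middle, close the hole at the bottom. -/
def bendF (Y : TwoCell (P := P) (𝗗 ⊳ 𝗠 ⊳ .nil) (𝗗 ⊳ 𝗠 ⊳ .nil)) :
    TwoCell (P := P) (𝗠 ⊳ 𝗗 ⊳ .nil) (𝗠 ⊳ 𝗗 ⊳ .nil) :=
  ((cεd P).wh .nil (𝗠 ⊳ 𝗗 ⊳ .nil)).comp ((Y.wh (𝗠 ⊲ .nil) (𝗗 ⊳ .nil)).comp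
    ((cε P).wh (𝗗 ⊲ 𝗠 ⊲ .nil) .nil))

/-- Open a hole at the bottom, apply `Y` in the middle, close the hole at the top. -/
def bendG (Y : TwoCell (P := P) (𝗗 ⊳ 𝗠 ⊳ .nil) (𝗗 ⊳ 𝗠 ⊳ .nil)) :
    TwoCell (P := P) (𝗠 ⊳ 𝗗 ⊳ .nil) (𝗠 ⊳ 𝗗 ⊳ .nil) :=
  ((cεd P).wh (𝗗 ⊲ 𝗠 ⊲ .nil) .nil).comp ((Y.wh (𝗠 ⊲ .nil) (𝗗 ⊳ .nil)).comp
    ((cε P).wh .nil (𝗠 ⊳ 𝗗 ⊳ .nil)))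

section Bend
variable (Y : TwoCell (P := P) (𝗗 ⊳ 𝗠 ⊳ .nil) (𝗗 ⊳ 𝗠 ⊳ .nil))

theorem slice_bendF (L : Ctx P 1 d) (R : Path P b 1) :
    slice L (bendF Y) R = slice L (cεd P) (𝗠 ⊳ 𝗗 ⊳ R) *
      (slice (𝗠 ⊲ L) Y (𝗗 ⊳ R) * slice (𝗗 ⊲ 𝗠 ⊲ L) (cε P) R) := by
  simp only [bendF, slice_comp, slice_wh]

theorem slice_bendG (L : Ctx P 1 d) (R : Path P b 1) :
    slice L (bendG Y) R = slice (𝗗 ⊲ 𝗠 ⊲ L) (cεd P) R *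
      (slice (𝗠 ⊲ L) Y (𝗗 ⊳ R) * slice L (cε P) (𝗠 ⊳ 𝗗 ⊳ R)) := by
  simp only [bendG, slice_comp, slice_wh]
end Bend

/-- Sliding the new hole around the handle exchanges the two Frobeniusators and the two ways of
bending. -/
theorem bendG_twistL (hP : P.IsRibbonObject) (z : Endo P) :
    bendG (twistL z) = bendF (twistR z) := by
  apply TwoCell.ext_slice
  rw [slice_bendG, slice_bendF, slice_twistL, slice_twistR, mul_assoc, mul_assoc, mul_assoc,
    mul_assoc, mul_mul_of_eq (cεd_cφli_copants hP _ _), cφl_cε hP, mul_assoc,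
    mul_mul_of_eq (cεd_cφri hP _ _), ← ca_cε hP, mul_assoc,
    exch_assoc (cα P) z.tr.tl .nil rfl rfl, exch_assoc (cα P) (ca P) .nil rfl rfl,
    exch_assoc z.tr.tl (ca P) .nil rfl rfl]

/-! ### Composing around a hole -/

theorem slice_loop (z w : Endo P) (L : Ctx P 1 d) (R : Path P b 1) :
    slice L (loop z w) R = slice L (cεd P) R * (slice (𝗠 ⊲ L) z.tr (𝗗 ⊳ R) *
      (slice (𝗠 ⊲ L) w.tl (𝗗 ⊳ R) * slice L (cε P) R)) := by
  simp only [loop, slice_comp, slice_wh]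

theorem slice_loop_tl (z w : Endo P) (L : Ctx P 2 d) (R : Path P b 2) :
    slice L (loop z w).tl R = slice L (cεd P).tl R * (slice ((𝗠).tl ⊲ L) z.tr.tl ((𝗗).tl ⊳ R) *
      (slice ((𝗠).tl ⊲ L) w.tl.tl ((𝗗).tl ⊳ R) * slice L (cε P).tl R)) := by
  simp only [loop, tl_comp, slice_comp, slice_tl_wh]

theorem slice_twistL_tr (z : Endo P) (L : Ctx P 3 d) (R : Path P b 3) :
    slice L (twistL z).tr R = slice L (cφli P).tr R *
      (slice ((𝗠).tr.tr ⊲ L) z.tr.tl.tr ((𝗗).tl.tr ⊳ R) * slice L (cφl P).tr R) := by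
  simp only [twistL, tr_comp, slice_comp, slice_tr_wh]

/-- A hole above the pants, with `w` on its right leg and `z` conjugated by the left Frobeniusator,
slides down into the right leg of the pants. -/
theorem loop_right_leg (hP : P.IsRibbonObject) (z w : Endo P) (L : Ctx P 1 d) (R : Path P b 2) :
    slice L (cεd P) (𝗠 ⊳ R) * (slice (𝗠 ⊲ L) w.tl (𝗗 ⊳ 𝗠 ⊳ R) *
      (slice (𝗠 ⊲ L) (twistL z) R * slice L (cε P) (𝗠 ⊳ R))) =
      slice (𝗠 ⊲ L) (loop z w).tl R := by
  rw [slice_twistL, slice_loop_tl, mul_assoc, mul_assoc, exch_assoc w.tl (cφli P) .nil rfl rfl,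
    mul_mul_of_eq (cεd_cφli hP _ _), cφl_cε hP, mul_assoc]
  dsimp only [Path.append, Ctx.push]
  rw [slide_right_M, exch_assoc w.tl.tl z.tr.tl .nil rfl rfl,
    ← exch_assoc (cα P) w.tl.tl .nil rfl rfl, ← exch_assoc (cα P) z.tr.tl .nil rfl rfl]
  dsimp only [Path.append, Ctx.push]
  rw [mul_mul_of_eq (slice_inv (cαi_cα hP) _ _)]
  simp only [idd_mul_slice_mul]

theorem loop_right_leg_tr (hP : P.IsRibbonObject) (z w : Endo P) (L : Ctx P 2 d)
    (R : Path P b 3) :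
    slice L (cεd P).tr ((𝗠).tr ⊳ R) * (slice ((𝗠).tr ⊲ L) w.tl.tr ((𝗗).tr ⊳ (𝗠).tr ⊳ R) *
      (slice ((𝗠).tr ⊲ L) (twistL z).tr R * slice L (cε P).tr ((𝗠).tr ⊳ R))) =
      slice ((𝗠).tr ⊲ L) (loop z w).tl.tr R := by
  have h : ((cεd P).wh .nil (𝗠 ⊳ .nil)).comp ((w.tl.wh (𝗠 ⊲ .nil) (𝗗 ⊳ 𝗠 ⊳ .nil)).comp
      (((twistL z).wh (𝗠 ⊲ .nil) .nil).comp ((cε P).wh .nil (𝗠 ⊳ .nil)))) =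
      (loop z w).tl.wh (𝗠 ⊲ .nil) .nil :=
    TwoCell.ext_slice (by simpa only [slice_comp, slice_wh] using loop_right_leg hP z w .nil .nil)
  simpa only [tr_comp, slice_comp, slice_tr_wh] using slice_tr_congr h L R

theorem cφr_cα (hP : P.IsRibbonObject) (L : Ctx P 2 d) (R : Path P b 3) :
    slice L (cφr P) ((𝗠).tr ⊳ R) * slice (𝗗 ⊲ L) (cα P) R =
      slice ((𝗠).tl ⊲ L) (cφli P).tr R * (slice L (cxi P) ((𝗗).tr.tl ⊳ R) *
        (slice ((𝗠).tr ⊲ L) (cφr P).tl R * slice L (cφl P) ((𝗠).tl ⊳ R))) := by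
  rw [← frobenius_bimodule hP, mul_mul_of_eq (slice_inv cxi_cx _ _)]
  simp only [idd_mul_slice_mul]
  rw [mul_mul_of_eq (slice_inv_tr (cφli_cφl hP) _ _)]
  simp only [idd_mul_slice_mul]

/-- The right action of the bimodule `D` intertwines `twistL z` with `twistL z ⊗ 1`. -/
theorem cφr_cα_twistL (hP : P.IsRibbonObject) (z : Endo P) (L : Ctx P 2 d) (R : Path P b 3) :
    slice L (cφr P) ((𝗠).tr ⊳ R) * (slice (𝗗 ⊲ L) (cα P) R * slice L (twistL z) ((𝗠).tl ⊳ R)) =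
      slice ((𝗠).tl ⊲ L) (twistL z).tr R *
        (slice L (cφr P) ((𝗠).tr ⊳ R) * slice (𝗗 ⊲ L) (cα P) R) := by
  rw [← mul_assoc, cφr_cα hP, mul_assoc, mul_assoc, mul_assoc, cφl_twistL hP,
    ← exch_assoc z.tr.tl (cφr P).tl .nil rfl rfl, slice_twistL_tr, mul_assoc, mul_assoc,
    mul_mul_of_eq (slice_inv_tr (cφl_cφli hP) _ _)]
  simp only [idd_mul_slice_mul]
  dsimp only [Path.append, Ctx.push]
  rw [slide_left_M_tl, exch_assoc (cxi P) z.tr.tr.tl .nil rfl rfl, slice_tl_tr _ z.tr]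

/-- Two conjugated endomorphisms, separated by an associator, merge into one `loop` on the middle
leg. The first of them has to be read on the other side of the hole, hence the hypothesis on `w`. -/
theorem loop_through_cα (hP : P.IsRibbonObject) {w : Endo P} (hw : IsRibbonEndo w) (z : Endo P)
    (L : Ctx P 1 d) (R : Path P b 3) :
    slice L (cεd P) (𝗠 ⊳ (𝗠).tr ⊳ R) * (slice (𝗠 ⊲ L) (twistL w) ((𝗠).tr ⊳ R) *
      (slice (𝗗 ⊲ 𝗠 ⊲ L) (cα P) R * (slice (𝗠 ⊲ L) (twistL z) ((𝗠).tl ⊳ R) *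
        slice L (cε P) (𝗠 ⊳ (𝗠).tl ⊳ R)))) =
      slice ((𝗠).tr ⊲ 𝗠 ⊲ L) (loop z w).tl.tr R * slice L (cα P) R := by
  rw [twistL_eq_twistR hP hw, slice_twistR, mul_assoc, mul_assoc,
    mul_mul_of_eq (cεd_cφri hP _ _), mul_assoc, mul_mul_mul_of_eq (cφr_cα_twistL hP _ _ _),
    mul_assoc, mul_assoc, ← exch (cε P) (cα P) .nil rfl rfl, mul_mul_of_eq (cφr_cε hP _ _),
    mul_assoc, exch_assoc (cα P) w.tr.tl .nil rfl rfl,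
    exch_assoc (cα P) (twistL z).tr .nil rfl rfl]
  dsimp only [Path.append, Ctx.push]
  rw [mul_mul_of_eq (slice_inv (cα_cαi hP) _ _)]
  simp only [idd_mul_slice_mul]
  rw [← loop_right_leg_tr hP, mul_assoc, mul_assoc, mul_assoc, slice_tl_tr]

/-- Two successive holes with conjugated endomorphisms merge into one. -/
theorem cεd_twistL_cεd_twistL (hP : P.IsRibbonObject) {w : Endo P} (hw : IsRibbonEndo w) (z : Endo P)
    (L : Ctx P 1 d) (R : Path P b 2) :
    slice L (cεd P) (𝗠 ⊳ R) * (slice (𝗠 ⊲ L) (twistL w) R *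
      (slice (𝗗 ⊲ 𝗠 ⊲ L) (cεd P) (𝗠 ⊳ R) * (slice (𝗠 ⊲ L) (twistL z) (𝗗 ⊳ 𝗠 ⊳ R) *
        slice L (cε P) (𝗠 ⊳ 𝗗 ⊳ 𝗠 ⊳ R)))) =
      slice L (cεd P) (𝗠 ⊳ R) * slice (𝗠 ⊲ L) (twistR (loop z w)) R := by
  rw [← cεd_cα_cφr hP (𝗗 ⊲ 𝗠 ⊲ L), mul_assoc, mul_assoc,
    ← exch_assoc (twistL z) (cφr P) .nil rfl rfl, ← exch (cε P) (cφr P) (𝗠 ⊳ .nil) rfl rfl,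
    exch_assoc (twistL w) (cεd P).tr .nil rfl rfl, 
    exch_assoc (cεd P) (cεd P).tr (𝗠 ⊳ .nil) rfl rfl]
  have h := congrArg (· * slice (𝗠 ⊲ L) (cφr P) R) (loop_through_cα hP hw z L ((𝗗).tr ⊳ R))
  simp only [mul_assoc] at h
  dsimp only [Path.append, Ctx.push]
  rw [h, slice_twistR, mul_mul_of_eq (cεd_cφri hP _ _), mul_assoc,
    exch_assoc (cα P) (loop z w).tr.tl .nil rfl rfl, slice_tl_tr]

/-- The two holes of the composite merge into one hole carrying `z` and `w` on its legs. -/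
theorem bendF_comp_bendG (hP : P.IsRibbonObject) {w : Endo P} (hw : IsRibbonEndo w)
    (z : Endo P) :
    (bendF (twistL w)).comp (bendG (twistL z)) = bendF (twistR (loop z w)) := by
  apply TwoCell.ext_slice
  rw [slice_comp, slice_bendF, slice_bendG, slice_bendF, mul_assoc, mul_assoc,
    ← exch_assoc (cεd P) (cε P) .nil rfl rfl,
    ← exch_assoc (twistL z) (cε P) (𝗗 ⊳ .nil) rfl rfl,
    ← exch (cε P) (cε P) (𝗠 ⊳ 𝗗 ⊳ .nil) rfl rfl]
  have h := congrArg (· * slice (𝗗 ⊲ 𝗠 ⊲ .nil) (cε P) .nil)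
    (cεd_twistL_cεd_twistL hP hw z .nil (𝗗 ⊳ .nil))
  simp only [mul_assoc] at h
  exact h

/-! ### Holes with a cut leg -/

theorem copants_zigzag_tl (hP : P.IsRibbonObject) (L : Ctx P 3 d) (R : Path P b 2) :
    slice L (cη P).tl ((𝗗).tl ⊳ R) * slice ((𝗗).tl ⊲ L) (cε P).tl R =
      idd (L.plug ((𝗗).tl ⊳ R)) := by
  simpa only [slice_comp, tl_comp, tl_id, slice_tl_wh, slice_id] using
    slice_tl_congr (copants_eq hP) L R

theorem twistL_id (hP : P.IsRibbonObject) : twistL (TwoCell.id (P := P) (n := 1) .nil) =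
    TwoCell.id _ := by
  apply TwoCell.ext_slice
  rw [slice_twistL, tr_id, tl_id, slice_id, slice_id]
  simp only [idd_mul_slice]
  exact slice_inv (cφli_cφl hP) _ _

theorem twistR_id (hP : P.IsRibbonObject) : twistR (TwoCell.id (P := P) (n := 1) .nil) =
    TwoCell.id _ := by
  apply TwoCell.ext_slice
  rw [slice_twistR, tr_id, tl_id, slice_id, slice_id]
  simp only [idd_mul_slice]
  exact slice_inv (cφri_cφr hP) _ _

/-- A hole above the pants slides down into the left leg of the pants. -/
theorem loop_left_leg (hP : P.IsRibbonObject) (z w : Endo P) (L : Ctx P 1 d) (R : Path P b 2) :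
    slice L (cεd P) (𝗠 ⊳ R) * (slice (𝗠 ⊲ L) z.tr (𝗗 ⊳ 𝗠 ⊳ R) *
      (slice (𝗠 ⊲ L) (twistR w) R * slice L (cε P) (𝗠 ⊳ R))) =
      slice (𝗠 ⊲ L) (loop z w).tr R := by
  have h : slice (𝗠 ⊲ L) (loop z w).tr R = slice (𝗠 ⊲ L) (cεd P).tr R *
      (slice ((𝗠).tr ⊲ 𝗠 ⊲ L) z.tr.tr ((𝗗).tr ⊳ R) *
      (slice ((𝗠).tr ⊲ 𝗠 ⊲ L) w.tl.tr ((𝗗).tr ⊳ R) * slice (𝗠 ⊲ L) (cε P).tr R)) := by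
    simp only [loop, tr_comp, slice_comp, slice_tr_wh]
  rw [slice_twistR, h, mul_assoc, mul_assoc, exch_assoc z.tr (cφri P) .nil rfl rfl,
    mul_mul_of_eq (cεd_cφri hP _ _), cφr_cε hP, mul_assoc]
  dsimp only [Path.append, Ctx.push]
  rw [slide_left_M, ← exch_assoc (cαi P) w.tr.tl .nil rfl rfl,
    ← exch_assoc (cαi P) z.tr.tr .nil rfl rfl]
  dsimp only [Path.append, Ctx.push]
  rw [mul_mul_of_eq (slice_inv (cα_cαi hP) _ _)]
  simp only [idd_mul_slice_mul]
  rw [slice_tl_tr]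

/-- Pinching a cylinder: `μ† ; μ`. -/
def neck (P : RibbonData C) : Endo P := (cμd P).comp (cμ P)

theorem slice_loop_id_left (w : Endo P) (L : Ctx P 1 d) (R : Path P b 1) :
    slice L (loop (TwoCell.id _) w) R = slice L (cεd P) R * (slice (𝗠 ⊲ L) w.tl (𝗗 ⊳ R) *
      slice L (cε P) R) := by
  rw [slice_loop, tr_id, slice_id]
  simp only [idd_mul_slice_mul]

theorem slice_loop_id_right (z : Endo P) (L : Ctx P 1 d) (R : Path P b 1) :
    slice L (loop z (TwoCell.id _)) R = slice L (cεd P) R * (slice (𝗠 ⊲ L) z.tr (𝗗 ⊳ R) *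
      slice L (cε P) R) := by
  rw [slice_loop, tl_id, slice_id]
  simp only [idd_mul_slice]

/-- An endomorphism of `id_X` that is trivial on the sphere `e ∘ u` is trivial on the disc `u`. -/
theorem slice_cup_of_sphere (hP : P.IsRibbonObject) {z : Endo P}
    (h : slice (𝗲 ⊲ 𝘂 ⊲ .nil) z (𝘂 ⊳ .nil) = idd (P := P) (𝘂 ⊳ 𝗲 ⊳ 𝘂 ⊳ .nil)) :
    z.wh .nil (𝘂 ⊳ .nil) = TwoCell.id (𝘂 ⊳ .nil) := by
  apply TwoCell.ext_slice
  rw [slice_wh, slice_id, ← cup_zigzag hP .nil .nil]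
  have h1 : slice (𝘂 ⊲ .nil) (cν P) .nil * (slice .nil (cμ P) (𝘂 ⊳ .nil) *
      slice .nil z (𝘂 ⊳ .nil)) = slice .nil z (𝘂 ⊳ .nil) := by
    rw [mul_mul_of_eq (cup_zigzag hP _ _)]
    simp only [idd_mul_slice]
  rw [exch (cμ P) z .nil rfl rfl] at h1
  dsimp only [Path.append, Ctx.push] at h1 ⊢
  rw [h] at h1
  simp only [idd_mul_slice] at h1
  exact h1.symm

theorem loop_neck_right (hP : P.IsRibbonObject) :
    loop (TwoCell.id _) (neck P) = TwoCell.id (P := P) .nil := by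
  set h := loop (TwoCell.id _) (neck P) with hh
  have hM : ∀ {b d : ℕ} (L : Ctx P 1 d) (R : Path P b 2),
      slice L h (𝗠 ⊳ R) = slice (𝗠 ⊲ L) h.tl R := fun L R => by
    rw [hh, ← loop_right_leg hP, twistL_id hP, slice_id, slice_loop_id_left]
    simp only [idd_mul_slice]
  have hu := slice_cup_of_sphere hP (z := h) (by
    rw [hh, slice_loop_id_left, neck, tl_comp, slice_comp, mul_assoc, pivotal_right hP])
  apply TwoCell.ext_slice
  have h1 := slice_tl_congr hu (𝗠 ⊲ .nil) .nil
  rw [slice_tl_wh, tl_id, slice_id] at h1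
  have h2 : slice .nil h .nil * (slice .nil (cρi P) .nil * slice .nil (cρ P) .nil) =
      slice .nil h .nil := by
    rw [slice_inv (cρi_cρ hP)]
    simp only [slice_mul_idd]
  rw [exch_assoc h (cρi P) .nil rfl rfl, hM] at h2
  dsimp only [Path.append, Ctx.push, Ctx.append] at h1 h2
  rw [h1] at h2
  simp only [idd_mul_slice] at h2
  rw [← h2, slice_id, slice_inv (cρi_cρ hP)]

theorem loop_neck_left (hP : P.IsRibbonObject) :
    loop (neck P) (TwoCell.id _) = TwoCell.id (P := P) .nil := by
  set h := loop (neck P) (TwoCell.id _) with hh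
  have hM : ∀ {b d : ℕ} (L : Ctx P 1 d) (R : Path P b 2),
      slice L h (𝗠 ⊳ R) = slice (𝗠 ⊲ L) h.tr R := fun L R => by
    rw [hh, ← loop_left_leg hP, twistR_id hP, slice_id, slice_loop_id_right]
    simp only [idd_mul_slice]
  have hu := slice_cup_of_sphere hP (z := h) (by
    rw [hh, slice_loop_id_right, neck, tr_comp, slice_comp, mul_assoc, pivotal_left hP])
  apply TwoCell.ext_slice
  have h1 := slice_tr_congr hu (𝗠 ⊲ .nil) .nil
  rw [slice_tr_wh, tr_id, slice_id] at h1
  have h2 : slice .nil h .nil * (slice .nil (cli P) .nil * slice .nil (cl P) .nil) =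
      slice .nil h .nil := by
    rw [slice_inv (cli_cl hP)]
    simp only [slice_mul_idd]
  rw [exch_assoc h (cli P) .nil rfl rfl, hM] at h2
  dsimp only [Path.append, Ctx.push, Ctx.append] at h1 h2
  rw [h1] at h2
  simp only [idd_mul_slice] at h2
  rw [← h2, slice_id, slice_inv (cli_cl hP)]

/-- The 2-morphism `id ⇒ D ∘ M` that opens a hole on the left strand, cuts its right leg, reglues it to
the strand on the right, and ends with the right Frobeniusator. -/
def cutMate (P : RibbonData C) : TwoCell (P := P) .nil (𝗗 ⊳ 𝗠 ⊳ .nil) :=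
  (cεd P).tr.comp (((cμd P).tr.tl.wh ((𝗠).tr ⊲ .nil) ((𝗗).tr ⊳ .nil)).comp
    (((cρ P).tr.wh .nil ((𝗲).tr.tl ⊳ (𝗗).tr ⊳ .nil)).comp
      (((cli P).tl.wh .nil ((𝗲).tr.tl ⊳ (𝗗).tr ⊳ .nil)).comp
        (((cμ P).tr.tl.wh ((𝗠).tl ⊲ .nil) ((𝗗).tr ⊳ .nil)).comp (cφr P)))))

theorem slice_cutMate (L : Ctx P 2 d) (R : Path P b 2) :
    slice L (cutMate P) R = slice L (cεd P).tr R *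
      (slice ((𝗠).tr ⊲ L) (cμd P).tr.tl ((𝗗).tr ⊳ R) *
        (slice L (cρ P).tr ((𝗲).tr.tl ⊳ (𝗗).tr ⊳ R) *
          (slice L (cli P).tl ((𝗲).tr.tl ⊳ (𝗗).tr ⊳ R) *
            (slice ((𝗠).tl ⊲ L) (cμ P).tr.tl ((𝗗).tr ⊳ R) * slice L (cφr P) R)))) := by
  simp only [cutMate, slice_comp, slice_wh]

theorem cρ_cli (hP : P.IsRibbonObject) (L : Ctx P 1 d) (R : Path P b 2) :
    slice (𝗠 ⊲ L) (cρ P).tr R * slice (𝗠 ⊲ L) (cli P).tl R =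
      slice L (cα P) ((𝘂).tr.tl ⊳ R) := by
  rw [triangle hP, mul_assoc, slice_inv_tl (cl_cli hP)]
  simp only [slice_mul_idd]

theorem cρ_cli_cαi (hP : P.IsRibbonObject) (L : Ctx P 1 d) (R : Path P b 2) :
    slice (𝗠 ⊲ L) (cρ P).tr R * (slice (𝗠 ⊲ L) (cli P).tl R *
      slice L (cαi P) ((𝘂).tr.tl ⊳ R)) = idd (L.plug (𝗠 ⊳ (𝗠).tr ⊳ (𝘂).tr.tl ⊳ R)) := by
  rw [← mul_assoc, cρ_cli hP, slice_inv (cα_cαi hP)]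

/-- The two sides have the same mate: on the mate, the cut hole closes up by `loop_neck_right`. -/
theorem cutMate_eq (hP : P.IsRibbonObject) : cutMate P = cη P := by
  apply ext_mate hP
  have h1 := slice_tr_congr (loop_neck_right hP) (𝗠 ⊲ 𝗗 ⊲ .nil) .nil
  simp only [loop, tr_comp, slice_comp, slice_tr_wh, neck, tl_comp, tr_id, slice_id] at h1
  rw [pants_zigzag hP, slice_cutMate, mul_assoc, mul_assoc, mul_assoc, mul_assoc, mul_assoc,
    cφr_cε hP, ← exch_assoc (cαi P) (cμ P).tr.tl .nil rfl rfl]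
  dsimp only [Path.append, Ctx.push, Ctx.append] at h1 ⊢
  rw [mul_mul_mul_of_eq (cρ_cli_cαi hP _ _)]
  simp only [idd_mul_slice_mul]
  simp only [slice_tl_tr, mul_assoc] at h1
  simp only [idd_mul_slice_mul] at h1
  exact h1

theorem cεd_twistR_neck (hP : P.IsRibbonObject) (L : Ctx P 1 d) (R : Path P b 2) :
    slice L (cεd P) (𝗠 ⊳ R) * slice (𝗠 ⊲ L) (twistR (neck P)) R = slice (𝗠 ⊲ L) (cη P) R := by
  rw [← cutMate_eq hP, slice_cutMate, slice_twistR, neck, tr_comp, tl_comp, slice_comp,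
    mul_mul_of_eq (cεd_cφri hP _ _), mul_mul_of_eq (cρ_cli hP _ _), mul_assoc, mul_assoc,
    exch_assoc (cα P) (cμd P).tr.tl .nil rfl rfl]

theorem bendF_twistR_neck (hP : P.IsRibbonObject) :
    bendF (twistR (neck P)) = TwoCell.id (P := P) _ := by
  apply TwoCell.ext_slice
  rw [slice_bendF, mul_mul_of_eq (cεd_twistR_neck hP _ _), copants_zigzag hP, slice_id]

/-! ### Recovering an endomorphism from its bend -/

/-- Transposing `bendF Y` along `D ⊣ M` leaves `Y` followed by the closing of the hole. -/
theorem slice_bendF_cηd (hP : P.IsRibbonObject)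
    (Y : TwoCell (P := P) (𝗗 ⊳ 𝗠 ⊳ .nil) (𝗗 ⊳ 𝗠 ⊳ .nil))
    (L : Ctx P 2 d) (R : Path P b 1) :
    slice (𝗗 ⊲ L) (bendF Y) R * slice L (cηd P) (𝗗 ⊳ R) =
      slice L Y (𝗗 ⊳ R) * slice (𝗗 ⊲ L) (cε P) R := by
  rw [slice_bendF, mul_assoc, mul_assoc, ← exch (cηd P) (cε P) (𝗗 ⊳ .nil) rfl rfl,
    ← exch_assoc (cηd P) Y .nil rfl rfl, mul_mul_of_eq (copants_dagger_zigzag hP _ _)]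
  simp only [idd_mul_slice_mul]

/-- The other leg of the copants is capped off with `e`, and the resulting cut hole is trivial. -/
theorem eq_of_copants_right (hP : P.IsRibbonObject) {z z' : Endo P}
    (h : z.tl.wh .nil (𝗗 ⊳ .nil) = z'.tl.wh .nil (𝗗 ⊳ .nil)) : z = z' := by
  have key : ∀ z : Endo P, slice .nil z .nil = slice .nil (cεd P) .nil *
      (slice (𝗠 ⊲ .nil) (cμd P).tr (𝗗 ⊳ .nil) * (slice .nil (cl P) ((𝗲).tr ⊳ 𝗗 ⊳ .nil) *
        (slice ((𝗲).tr ⊲ .nil) z.tl (𝗗 ⊳ .nil) * (slice .nil (cli P) ((𝗲).tr ⊳ 𝗗 ⊳ .nil) *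
          (slice (𝗠 ⊲ .nil) (cμ P).tr (𝗗 ⊳ .nil) * slice .nil (cε P) .nil))))) := fun z => by
    have h1 := slice_congr (loop_neck_left hP) .nil .nil
    rw [slice_loop_id_right, neck, tr_comp, slice_comp, slice_id, mul_assoc] at h1
    rw [← slide_right_e, exch_assoc z (cli P) .nil rfl rfl]
    dsimp only [Path.append, Ctx.push]
    rw [exch_assoc z (cμ P).tr (𝗠 ⊳ .nil) rfl rfl, exch z (cε P) .nil rfl rfl]
    dsimp only [Path.append, Ctx.push]
    rw [mul_mul_of_eq (slice_inv (cl_cli hP) _ _)]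
    simp only [idd_mul_slice_mul]
    have h2 := congrArg (· * slice .nil z .nil) h1
    simp only [mul_assoc] at h2
    dsimp only [Path.append, Ctx.plug] at h2 ⊢
    rw [h2]
    simp only [idd_mul_slice]
  have hL := fun L => slice_congr h (L : Ctx P 2 1) .nil
  simp only [slice_wh] at hL
  apply TwoCell.ext_slice
  rw [key z, key z', hL]

/-- The cup is removed by growing a pair of pants with a capped-off leg and sliding `z` through the
left Frobeniusator. -/
theorem slice_tl_copants (hP : P.IsRibbonObject) {z z' : Endo P}
    (h : z.tl.wh .nil (𝗗 ⊳ 𝘂 ⊳ .nil) = z'.tl.wh .nil (𝗗 ⊳ 𝘂 ⊳ .nil)) :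
    z.tl.wh .nil (𝗗 ⊳ .nil) = z'.tl.wh .nil (𝗗 ⊳ .nil) := by
  have key : ∀ z : Endo P, slice .nil z.tl (𝗗 ⊳ .nil) = slice (𝗗 ⊲ .nil) (cρi P) .nil *
      (slice .nil (cφli P) ((𝘂).tl ⊳ .nil) *
        (slice ((𝗠).tr ⊲ .nil) z.tl.tl ((𝗗).tl ⊳ (𝘂).tl ⊳ .nil) *
          (slice .nil (cφl P) ((𝘂).tl ⊳ .nil) * slice (𝗗 ⊲ .nil) (cρ P) .nil))) := fun z => by
    rw [← slide_right_M, exch_assoc z.tl (cφl P) .nil rfl rfl,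
      mul_mul_of_eq (slice_inv (cφli_cφl hP) _ _)]
    dsimp only [Path.append, Ctx.push]
    rw [exch z.tl (cρ P) (𝗗 ⊳ .nil) rfl rfl]
    simp only [idd_mul_slice_mul]
    dsimp only [Path.append, Ctx.push]
    rw [mul_mul_of_eq (slice_inv (cρi_cρ hP) _ _)]
    simp only [idd_mul_slice]
  have h' := slice_tl_congr h ((𝗠).tr ⊲ .nil) .nil
  simp only [slice_tl_wh] at h'
  apply TwoCell.ext_slice
  simp only [slice_wh]
  dsimp only [Path.append, Ctx.append, Path.tl, Ctx.tl] at h' ⊢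
  rw [key z, key z', h']

/-- The third leg is capped off with `e`, and the resulting cut hole is trivial. -/
theorem tl_of_middle (hP : P.IsRibbonObject) {z z' : Endo P}
    (h : z.tr.tl.wh .nil ((𝗗).tr ⊳ 𝗗 ⊳ 𝘂 ⊳ .nil) =
      z'.tr.tl.wh .nil ((𝗗).tr ⊳ 𝗗 ⊳ 𝘂 ⊳ .nil)) :
    z.tl.wh .nil (𝗗 ⊳ 𝘂 ⊳ .nil) = z'.tl.wh .nil (𝗗 ⊳ 𝘂 ⊳ .nil) := by
  have key : ∀ z : Endo P, slice .nil z.tl (𝗗 ⊳ 𝘂 ⊳ .nil) =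
      slice (𝗗 ⊲ .nil) (cεd P) (𝘂 ⊳ .nil) * (slice (𝗠 ⊲ 𝗗 ⊲ .nil) (cμd P).tl (𝗗 ⊳ 𝘂 ⊳ .nil) *
        (slice (𝗗 ⊲ .nil) (cρ P) ((𝗲).tl ⊳ 𝗗 ⊳ 𝘂 ⊳ .nil) *
          (slice .nil (cy P) (𝗗 ⊳ 𝘂 ⊳ .nil) *
            (slice ((𝗲).tl.tl ⊲ .nil) z.tr.tl ((𝗗).tr ⊳ 𝗗 ⊳ 𝘂 ⊳ .nil) *
              (slice .nil (cyi P) (𝗗 ⊳ 𝘂 ⊳ .nil) *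
                (slice (𝗗 ⊲ .nil) (cρi P) ((𝗲).tl ⊳ 𝗗 ⊳ 𝘂 ⊳ .nil) *
                  (slice (𝗠 ⊲ 𝗗 ⊲ .nil) (cμ P).tl (𝗗 ⊳ 𝘂 ⊳ .nil) *
                    slice (𝗗 ⊲ .nil) (cε P) (𝘂 ⊳ .nil)))))))) := fun z => by
    have h1 := slice_congr (loop_neck_right hP) (𝗗 ⊲ .nil) (𝘂 ⊳ .nil)
    rw [slice_loop_id_left, neck, tl_comp, slice_comp, slice_id, mul_assoc] at h1
    rw [← slide_left_e_tl, exch_assoc z.tl (cyi P) .nil rfl rfl,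
      mul_mul_of_eq (slice_inv cy_cyi _ _)]
    dsimp only [Path.append, Ctx.push]
    rw [exch_assoc z.tl (cρi P) (𝗗 ⊳ .nil) rfl rfl]
    dsimp only [Path.append, Ctx.push]
    rw [exch_assoc z.tl (cμ P).tl (𝗗 ⊳ 𝗠 ⊳ .nil) rfl rfl,
      exch z.tl (cε P) (𝗗 ⊳ .nil) rfl rfl]
    simp only [idd_mul_slice_mul]
    dsimp only [Path.append, Ctx.push]
    rw [mul_mul_of_eq (slice_inv (cρ_cρi hP) _ _)]
    simp only [idd_mul_slice_mul]
    have h2 := congrArg (· * slice .nil z.tl (𝗗 ⊳ 𝘂 ⊳ .nil)) h1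
    simp only [mul_assoc] at h2
    dsimp only [Path.append, Ctx.plug] at h2 ⊢
    rw [h2]
    simp only [idd_mul_slice]
  have h' := slice_congr h ((𝗲).tl.tl ⊲ .nil) .nil
  simp only [slice_wh] at h'
  apply TwoCell.ext_slice
  simp only [slice_wh]
  dsimp only [Path.append, Ctx.append] at h' ⊢
  rw [key z, key z', h']

/-- The coassociator is cancelled by `ca_cφl_cε` and the adjunction `M ⊣ D` on the first two legs. -/
theorem middle_of_ca (hP : P.IsRibbonObject) {z z' : Endo P}
    (h : (z.tr.tl.wh .nil ((𝗗).tr ⊳ 𝗗 ⊳ 𝘂 ⊳ .nil)).comp ((ca P).wh .nil (𝘂 ⊳ .nil)) =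
      (z'.tr.tl.wh .nil ((𝗗).tr ⊳ 𝗗 ⊳ 𝘂 ⊳ .nil)).comp ((ca P).wh .nil (𝘂 ⊳ .nil))) :
    z.tr.tl.wh .nil ((𝗗).tr ⊳ 𝗗 ⊳ 𝘂 ⊳ .nil) = z'.tr.tl.wh .nil ((𝗗).tr ⊳ 𝗗 ⊳ 𝘂 ⊳ .nil) := by
  have key : ∀ z : Endo P, slice .nil z.tr.tl ((𝗗).tr ⊳ 𝗗 ⊳ 𝘂 ⊳ .nil) =
      slice .nil (cη P).tr ((𝗗).tr ⊳ 𝗗 ⊳ 𝘂 ⊳ .nil) *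
        (slice ((𝗠).tr ⊲ (𝗗).tr ⊲ .nil) z.tr.tl ((𝗗).tr ⊳ 𝗗 ⊳ 𝘂 ⊳ .nil) *
          (slice ((𝗠).tr ⊲ (𝗗).tr ⊲ .nil) (ca P) (𝘂 ⊳ .nil) *
            (slice ((𝗗).tr ⊲ .nil) (cφl P) (𝗗 ⊳ 𝘂 ⊳ .nil) *
              slice (𝗗 ⊲ (𝗗).tr ⊲ .nil) (cε P) (𝘂 ⊳ .nil)))) := fun z => by
    rw [ca_cφl_cε hP, exch_assoc (cη P).tr z.tr.tl .nil rfl rfl]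
    dsimp only [Path.append, Ctx.push]
    rw [copants_zigzag_tr hP]
    simp only [slice_mul_idd]
  have h' := slice_congr h ((𝗠).tr ⊲ (𝗗).tr ⊲ .nil) .nil
  simp only [slice_wh, slice_comp] at h'
  apply TwoCell.ext_slice
  simp only [slice_wh]
  dsimp only [Path.append, Ctx.append] at h' ⊢
  rw [key z, key z', mul_mul_of_eq h', mul_assoc]

/-- The adjunctions `D ⊣ M` and `M ⊣ D` strip the hole and the pants off `bendF (twistR z)`. -/
theorem ca_of_bendF (hP : P.IsRibbonObject) {z z' : Endo P}
    (h : (bendF (twistR z)).wh .nil (𝘂 ⊳ .nil) = (bendF (twistR z')).wh .nil (𝘂 ⊳ .nil)) :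
    (z.tr.tl.wh .nil ((𝗗).tr ⊳ 𝗗 ⊳ 𝘂 ⊳ .nil)).comp ((ca P).wh .nil (𝘂 ⊳ .nil)) =
      (z'.tr.tl.wh .nil ((𝗗).tr ⊳ 𝗗 ⊳ 𝘂 ⊳ .nil)).comp ((ca P).wh .nil (𝘂 ⊳ .nil)) := by
  have key : ∀ z : Endo P, slice .nil z.tr.tl ((𝗗).tr ⊳ 𝗗 ⊳ 𝘂 ⊳ .nil) *
      slice .nil (ca P) (𝘂 ⊳ .nil) = slice .nil (cη P).tl ((𝗗).tr ⊳ 𝗗 ⊳ 𝘂 ⊳ .nil) *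
        (slice ((𝗗).tl ⊲ .nil) (cφr P) (𝗗 ⊳ 𝘂 ⊳ .nil) *
          (slice (𝗗 ⊲ (𝗗).tl ⊲ .nil) (bendF (twistR z)) (𝘂 ⊳ .nil) *
            slice ((𝗗).tl ⊲ .nil) (cηd P) (𝗗 ⊳ 𝘂 ⊳ .nil))) := fun z => by
    rw [slice_bendF_cηd hP, mul_mul_of_eq (cφr_twistR hP _ _ _), mul_assoc, ← ca_cε hP,
      exch_assoc (cη P).tl z.tr.tl .nil rfl rfl]
    dsimp only [Path.append, Ctx.push]
    rw [exch_assoc (cη P).tl (ca P) .nil rfl rfl]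
    dsimp only [Path.append, Ctx.push]
    rw [copants_zigzag_tl hP]
    simp only [slice_mul_idd]
  have h' := slice_congr h (𝗗 ⊲ (𝗗).tl ⊲ .nil) .nil
  simp only [slice_wh] at h'
  apply TwoCell.ext_slice
  simp only [slice_wh, slice_comp]
  dsimp only [Path.append, Ctx.append] at h' ⊢
  rw [key z, key z', h']

/-- An endomorphism of `id_X` is determined by its bend on the once-punctured torus. -/
theorem eq_of_bendF_cup (hP : P.IsRibbonObject) {z z' : Endo P}
    (h : (bendF (twistR z)).wh .nil (𝘂 ⊳ .nil) = (bendF (twistR z')).wh .nil (𝘂 ⊳ .nil)) :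
    z = z' :=
  eq_of_copants_right hP (slice_tl_copants hP (tl_of_middle hP (middle_of_ca hP
    (ca_of_bendF hP h))))

/-! ### Modularity and the punctured tori -/

theorem isRibbonEndo_cθ (hP : P.IsRibbonObject) : IsRibbonEndo (cθ P) := ribbon_eq hP

theorem IsRibbonEndo.inv {z z' : Endo P} (hz : IsRibbonEndo z) (h : z.comp z' = TwoCell.id _)
    (h' : z'.comp z = TwoCell.id _) : IsRibbonEndo z' := by
  have hs := slice_congr hz .nil .nil
  simp only [slice_wh] at hs
  apply TwoCell.ext_slice
  simp only [slice_wh]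
  dsimp only [Path.append, Ctx.append] at hs ⊢
  have h1 : slice .nil z'.tr (𝗗 ⊳ 𝘂 ⊳ .nil) * (slice .nil z.tl (𝗗 ⊳ 𝘂 ⊳ .nil) *
      slice .nil z'.tl (𝗗 ⊳ 𝘂 ⊳ .nil)) = slice .nil z'.tr (𝗗 ⊳ 𝘂 ⊳ .nil) := by
    rw [slice_inv_tl h]
    simp only [slice_mul_idd]
  rw [← h1, ← hs, mul_mul_of_eq (slice_inv_tr h' _ _)]
  simp only [idd_mul_slice]

theorem isRibbonEndo_cθi (hP : P.IsRibbonObject) : IsRibbonEndo (cθi P) :=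
  (isRibbonEndo_cθ hP).inv (cθ_cθi hP) (cθi_cθ hP)

theorem loop_eq (z w : Endo P) : loop z w =
    (cεd P).comp (((z.tr.comp w.tl).wh (𝗠 ⊲ .nil) (𝗗 ⊳ .nil)).comp (cε P)) := by
  apply TwoCell.ext_slice
  simp only [slice_loop, slice_comp, slice_wh, mul_assoc]

theorem cell_loop (z w : Endo P) : (loop z w).cell = C.vcomp P.εd
    (C.vcomp (C.hcomp (C.idc P.M) (C.hcomp (P.two z.cell w.cell) (C.idc P.D))) P.ε) := by
  simp only [loop_eq, comp_cell, wh_cons, Ctx.ev_singleton, Path.ev_singleton, mor_LM, mor_LD,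
    tl_cell, tr_cell]
  rfl

theorem modularity_iff : P.Modularity ↔
    loop (cθ P) (cθi P) = neck P ∧ loop (cθi P) (cθ P) = neck P := by
  have h : ∀ z w : Endo P, loop z w = neck P ↔ C.vcomp P.εd
      (C.vcomp (C.hcomp (C.idc P.M) (C.hcomp (P.two z.cell w.cell) (C.idc P.D))) P.ε) =
        C.vcomp P.μd P.μ := fun z w => by
    rw [← cell_loop]
    exact ⟨fun h => by rw [h]; rfl, fun h => TwoCell.ext' h⟩
  rw [h, h]
  exact ⟨fun h => ⟨h.mod, h.mod_rot⟩, fun h => ⟨h.1, h.2⟩⟩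

theorem cell_bendG : (bendG (twistL (cθi P))).cell = P.A := by
  simp only [bendG, twistL, comp_cell, wh_nil_left, wh_nil_right, wh_cons, Ctx.ev_singleton,
    Path.ev_singleton, Ctx.ev_pair, Path.ev_pair, mor_LM, mor_LD, Layer.mor_tl, Layer.mor_tr,
    tl_cell, tr_cell, cell_cφl, cell_cφli]
  rfl

theorem cell_bendF : (bendF (twistL (cθ P))).cell = P.Ad := by
  simp only [bendF, twistL, comp_cell, wh_nil_left, wh_nil_right, wh_cons, Ctx.ev_singleton,
    Path.ev_singleton, Ctx.ev_pair, Path.ev_pair, mor_LM, mor_LD, Layer.mor_tl, Layer.mor_tr,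
    tl_cell, tr_cell, cell_cφl, cell_cφli]
  rfl

theorem bendG_comp_bendF (hP : P.IsRibbonObject) :
    (bendG (twistL (cθi P))).comp (bendF (twistL (cθ P))) =
      bendF (twistR (loop (cθ P) (cθi P))) := by
  rw [bendG_twistL hP, ← twistL_eq_twistR hP (isRibbonEndo_cθi hP),
    twistL_eq_twistR hP (isRibbonEndo_cθ hP), ← bendG_twistL hP,
    bendF_comp_bendG hP (isRibbonEndo_cθi hP)]

theorem invertibleOnTorus₂_iff (hP : P.IsRibbonObject) : P.InvertibleOnTorus₂ ↔
    bendF (twistR (loop (cθ P) (cθi P))) = TwoCell.id _ ∧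
      bendF (twistR (loop (cθi P) (cθ P))) = TwoCell.id _ := by
  have hid : (TwoCell.id (P := P) (𝗠 ⊳ 𝗗 ⊳ .nil)).cell = C.idc P.torus₂ := by
    rw [id_cell, Path.ev_pair, mor_LM, mor_LD]; rfl
  rw [← bendG_comp_bendF hP, ← bendF_comp_bendG hP (isRibbonEndo_cθ hP), InvertibleOnTorus₂,
    ← cell_bendG, ← cell_bendF, ← hid]
  exact ⟨fun h => ⟨TwoCell.ext' h.1, TwoCell.ext' h.2⟩,
    fun h => ⟨congrArg TwoCell.cell h.1, congrArg TwoCell.cell h.2⟩⟩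

theorem invertibleOnTorus₁_iff (hP : P.IsRibbonObject) : P.InvertibleOnTorus₁ ↔
    (bendF (twistR (loop (cθ P) (cθi P)))).wh .nil (𝘂 ⊳ .nil) = TwoCell.id _ ∧
      (bendF (twistR (loop (cθi P) (cθ P)))).wh .nil (𝘂 ⊳ .nil) = TwoCell.id _ := by
  have hid : (TwoCell.id (P := P) (𝗠 ⊳ 𝗗 ⊳ 𝘂 ⊳ .nil)).cell = C.idc P.torus₁ := by
    rw [id_cell, Path.ev_cons, Path.ev_pair, mor_LM, mor_LD, mor_Lu]; rfl
  have hc : ∀ a b : TwoCell (P := P) (𝗠 ⊳ 𝗗 ⊳ .nil) (𝗠 ⊳ 𝗗 ⊳ .nil),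
      ((a.comp b).wh .nil (𝘂 ⊳ .nil) = TwoCell.id _ ↔
        C.vcomp (C.hcomp a.cell (C.idc P.u)) (C.hcomp b.cell (C.idc P.u)) =
          C.idc P.torus₁) := fun a b => by
    have h : (a.comp b).wh .nil (𝘂 ⊳ .nil) =
        (a.wh .nil (𝘂 ⊳ .nil)).comp (b.wh .nil (𝘂 ⊳ .nil)) :=
      TwoCell.ext_slice (by simp only [slice_wh, slice_comp])
    rw [h, ← hid, ← mor_Lu, ← Path.ev_singleton, ← wh_nil_left, ← wh_nil_left, ← comp_cell]
    exact ⟨congrArg TwoCell.cell, TwoCell.ext'⟩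
  rw [← bendG_comp_bendF hP, ← bendF_comp_bendG hP (isRibbonEndo_cθ hP), hc, hc, cell_bendG,
    cell_bendF]
  rfl

end RibbonData

theorem proposition25 (C : QuasistrictSymmMonoidal2Cat) (P : RibbonData C)
    (hP : P.IsRibbonObject) :
    List.TFAE [P.Modularity, P.InvertibleOnTorus₂, P.InvertibleOnTorus₁] := by
  rw [RibbonData.modularity_iff, RibbonData.invertibleOnTorus₂_iff hP,
    RibbonData.invertibleOnTorus₁_iff hP]
  tfae_have 1 → 2 := fun h => by
    rw [h.1, h.2, RibbonData.bendF_twistR_neck hP]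
    exact ⟨rfl, rfl⟩
  tfae_have 2 → 3 := fun h => by
    rw [h.1, h.2]
    refine ⟨?_, ?_⟩ <;> exact RibbonData.TwoCell.ext_slice (by
      rw [RibbonData.slice_wh, RibbonData.slice_id, RibbonData.slice_id])
  tfae_have 3 → 1 := fun h => by
    have hn : (RibbonData.bendF (RibbonData.twistR (RibbonData.neck P))).wh .nil
        (.cons (RibbonData.Lu P) .nil) = RibbonData.TwoCell.id _ :=
      RibbonData.TwoCell.ext_slice (by
        rw [RibbonData.bendF_twistR_neck hP, RibbonData.slice_wh, RibbonData.slice_id,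
          RibbonData.slice_id])
    exact ⟨RibbonData.eq_of_bendF_cup hP (h.1.trans hn.symm),
      RibbonData.eq_of_bendF_cup hP (h.2.trans hn.symm)⟩
  tfae_finish
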